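/- Let $A\in\mathbb R^{n\times n}$, $B\in\mathbb R^{n\times m}$, $Q=Q^\top\succeq 0$ in $\mathbb R^{n\times n}$ and $R=R^\top\succ 0$ in $\mathbb R^{m\times m}$. Assume that $(A,B)$ is stabilizable and that every eigenvalue of $A$ on the imaginary axis is $(Q,A)$-observable (if $Av=\lambda v$ with $v\in\mathbb C^n\setminus\{0\}$ and $\operatorname{Re}\lambda=0$, then $Qv\neq 0$). Let $x_0^1,\dots,x_0^n$ span $\mathbb R^n$. Let $\mathcal H=\{K\in\mathbb R^{m\times n}: A-BK \text{ is Hurwitz}\}$ be the set of stabilizing gains, where a matrix is Hurwitz if all its eigenvalues have negative real part, and for $K\in\mathcal H$ let $$f(K)=\sum_{j=1}^n\int_0^\infty \big(\langle x_j(t),Qx_j(t)\rangle+\langle u_j(t),Ru_j(t)\rangle\big)\,dt,\qquad x_j(t)=e^{t(A-BK)}x_0^j,\quad u_j(t)=-Kx_j(t).$$ Let $\nabla f$ be the gradient of $f$ for the Frobenius inner product $\langle M,N\rangle=\operatorname{Tr}(M^\top N)$. Then $f$ has a unique global minimizer $K_*$ on $\mathcal H$, and for every $K_0\in\mathcal H$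 the following hold. 1. The initial value problem $\dot K_t=-\nabla f(K_t)$, $K(0)=K_0$, has a unique solution $t\mapsto K_t\in\mathcal H$ on $[0,\infty)$, and this solution is $C^\infty$ on $[0,\infty)$. 2. There are constants $\alpha>0$ and $c>0$, determined by $A,B,Q,R,x_0^1,\dots,x_0^n$ and $K_0$, such that for all $t\ge 0$ $$f(K_t)-f(K_*)\le e^{-\alpha t}\,\big(f(K_0)-f(K_*)\big),\qquad \|K_t-K_*\|_F^2\le c\,e^{-\alpha t}\,\|K_0-K_*\|_F^2 .$$ Moreover, the same constants $\alpha$ and $c$ serve for the gradient flow started at any point $L_0$ of the sublevel set $\{L\in\mathcal H: f(L)\le f(K_0)\}$ (with $L_0$ in place of $K_0$ in these bounds), so the trajectories are exponentially stable in the sense of Lyapunov. -/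

import Mathlib

open Set
open scoped Matrix ContDiff

/-- A real square matrix is Hurwitz stable if all its complex eigenvalues have negative
real part. -/
def IsHurwitz {n : ℕ} (M : Matrix (Fin n) (Fin n) ℝ) : Prop :=
  ∀ μ ∈ spectrum ℂ (M.map (algebraMap ℝ ℂ)), μ.re < 0

/-- The set `𝓗` of stabilizing feedback gains: those `K` for which `A - B K` is Hurwitz. -/
def stabilizingGains {n m : ℕ} (A : Matrix (Fin n) (Fin n) ℝ) (B : Matrix (Fin n) (Fin m) ℝ) :
    Set (Matrix (Fin m) (Fin n) ℝ) :=
  {K | IsHurwitz (A - B * K)}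

/-- The pair `(A, B)` is stabilizable: some feedback gain makes `A - B K` Hurwitz. -/
def IsStabilizable {n m : ℕ} (A : Matrix (Fin n) (Fin n) ℝ) (B : Matrix (Fin n) (Fin m) ℝ) :
    Prop :=
  ∃ K : Matrix (Fin m) (Fin n) ℝ, IsHurwitz (A - B * K)

/-- Every eigenvalue of `A` on the imaginary axis is `(Q, A)`-observable: no eigenvector of `A`
belonging to such an eigenvalue is annihilated by `Q`. -/
def ImaginaryAxisObservable {n : ℕ} (Q A : Matrix (Fin n) (Fin n) ℝ) : Prop :=
  ∀ (μ : ℂ) (v : Fin n → ℂ), μ.re = 0 → v ≠ 0 →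
    (A.map (algebraMap ℝ ℂ)) *ᵥ v = μ • v → (Q.map (algebraMap ℝ ℂ)) *ᵥ v ≠ 0

/-- The state trajectory `x(t) = e^{t (A - B K)} ξ` of `ẋ = A x + B u` under the feedback
`u = - K x`, started at `ξ`. -/
noncomputable def closedLoopState {n m : ℕ} (A : Matrix (Fin n) (Fin n) ℝ)
    (B : Matrix (Fin n) (Fin m) ℝ) (K : Matrix (Fin m) (Fin n) ℝ) (ξ : Fin n → ℝ) (t : ℝ) :
    Fin n → ℝ :=
  NormedSpace.exp (t • (A - B * K)) *ᵥ ξ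

/-- The control input `u(t) = - K x(t)`. -/
noncomputable def closedLoopInput {n m : ℕ} (A : Matrix (Fin n) (Fin n) ℝ)
    (B : Matrix (Fin n) (Fin m) ℝ) (K : Matrix (Fin m) (Fin n) ℝ) (ξ : Fin n → ℝ) (t : ℝ) :
    Fin m → ℝ :=
  -(K *ᵥ closedLoopState A B K ξ t)

/-- The LQR cost `J_ξ(K) = ∫₀^∞ (⟨x, Q x⟩ + ⟨u, R u⟩) dt` along the closed loop. For `K ∈ 𝓗` the
integrand decays exponentially, so the integral is an honest one; only such `K` are used. -/
noncomputable def lqrCostFrom {n m : ℕ} (A : Matrix (Fin n) (Fin n) ℝ)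
    (B : Matrix (Fin n) (Fin m) ℝ) (Q : Matrix (Fin n) (Fin n) ℝ) (R : Matrix (Fin m) (Fin m) ℝ)
    (ξ : Fin n → ℝ) (K : Matrix (Fin m) (Fin n) ℝ) : ℝ :=
  ∫ t in Ioi (0 : ℝ),
    (closedLoopState A B K ξ t ⬝ᵥ (Q *ᵥ closedLoopState A B K ξ t) +
      closedLoopInput A B K ξ t ⬝ᵥ (R *ᵥ closedLoopInput A B K ξ t))

/-- The cost function `f(K) = ∑ⱼ J_{x₀ʲ}(K)`, summed over the initial conditions
`x₀¹, …, x₀ⁿ`. -/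
noncomputable def lqrCost {n m : ℕ} (A : Matrix (Fin n) (Fin n) ℝ)
    (B : Matrix (Fin n) (Fin m) ℝ) (Q : Matrix (Fin n) (Fin n) ℝ) (R : Matrix (Fin m) (Fin m) ℝ)
    (x₀ : Fin n → Fin n → ℝ) (K : Matrix (Fin m) (Fin n) ℝ) : ℝ :=
  ∑ j, lqrCostFrom A B Q R (x₀ j) K

-- From here on `‖·‖` on matrices is the Frobenius norm.
attribute [local instance] Matrix.frobeniusNormedAddCommGroup Matrix.frobeniusNormedSpace

/-- The Frobenius inner product `⟨M, N⟩ = Tr(Mᵀ N)` on real `m × n` matrices. -/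
noncomputable instance frobeniusInnerProductSpace {m n : ℕ} :
    InnerProductSpace ℝ (Matrix (Fin m) (Fin n) ℝ) where
  toNormedSpace := Matrix.frobeniusNormedSpace
  inner M N := (Mᵀ * N).trace
  norm_sq_eq_re_inner M := by
    rw [Matrix.frobenius_norm_def, ← Real.sqrt_eq_rpow, Real.sq_sqrt (by positivity)]
    simp only [Matrix.trace, Matrix.diag, Matrix.mul_apply, Matrix.transpose_apply]
    rw [Finset.sum_comm]
    simp [pow_two]
  conj_inner_symm M N := by
    simp [← Matrix.trace_transpose (Mᵀ * N)]
  add_left M N P := by simp [Matrix.add_mul]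
  smul_left M N r := by simp

/-- `K : ℝ → 𝕄_{m×n}(ℝ)`, restricted to `[0, ∞)`, is a solution in `𝓗` of the initial value
problem `K̇ = -∇f(K)`, `K(0) = K₀`, the gradient being taken for the Frobenius inner product. At
`t = 0` the derivative is one-sided. -/
structure IsGradientFlowFrom {n m : ℕ} (A : Matrix (Fin n) (Fin n) ℝ)
    (B : Matrix (Fin n) (Fin m) ℝ) (Q : Matrix (Fin n) (Fin n) ℝ) (R : Matrix (Fin m) (Fin m) ℝ)
    (x₀ : Fin n → Fin n → ℝ) (K₀ : Matrix (Fin m) (Fin n) ℝ)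
    (K : ℝ → Matrix (Fin m) (Fin n) ℝ) : Prop where
  init : K 0 = K₀
  mem : ∀ t, 0 ≤ t → K t ∈ stabilizingGains A B
  deriv : ∀ t, 0 ≤ t →
    HasDerivWithinAt K (-gradient (lqrCost A B Q R x₀) (K t)) (Ici 0) t

/-! The cost is not convex in general, but Lyapunov equations make it algebraic. For stabilizing `K`
let `P(K)` solve `(A - BK)ᵀ P + P (A - BK) = -(Q + Kᵀ R K)`, let `X(K)` be the closed-loop Gramian
and put `E(K) = R K - Bᵀ P(K)`. Trace duality between the two Lyapunov equations gives the exact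
identity `lqrCost_sub`: f(L) - f(K) = 2⟪E(K) X(L), L - K⟫ + ⟪R (L - K) X(L), L - K⟫. Letting L tend
to K gives ∇f(K) = 2 E(K) X(K). Since X(K) is positive definite, E vanishes at a minimizer K⋆, so
f(L) - f(K⋆) is a pure quadratic form in L - K⋆ with weights R and X(L). Taking L = K⋆ instead and
completing the square bounds f(K) - f(K⋆) by a multiple of ‖E(K)‖², hence of ‖∇f(K)‖²: a
Polyak–Łojasiewicz inequality.

The constants are uniform because sublevel sets are compact (`isCompact_sublevel_lqrCost`). The
initial states span, so X(K) is bounded below by a multiple of 1 / (‖A - BK‖ + 1), and a bounded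
cost bounds K. If the Gramians blew up along such gains, their normalized limit would be a nonzero Y
⪰ 0 with A Y + Y Aᵀ = 0 and Q Y = 0, which observability of the imaginary-axis eigenvalues forbids.

Compactness yields the minimizer and the global smooth flow; gradient dominance yields exponential
decay of the cost; the two-sided quadratic bounds transfer the rate to ‖K_t - K⋆‖². -/

/-! ### Gradient flows on open sets with compact sublevel sets -/

section GradientFlow

open Filter Topology

/-- A bounded Lipschitz vector field on a Banach space has complete integral curves. -/
theorem exists_integralCurve_of_lipschitz_of_bounded {E : Type*} [NormedAddCommGroup E]
    [NormedSpace ℝ E] [CompleteSpace E] {v : E → E} {k : NNReal} (hv : LipschitzWith k v)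
    {C : ℝ} (hC : ∀ x, ‖v x‖ ≤ C) (x₀ : E) :
    ∃ x : ℝ → E, x 0 = x₀ ∧ ∀ t, HasDerivAt x (v (x t)) t := by
  have key : ∀ N : ℕ, ∃ a : ℝ → E, a 0 = x₀ ∧
      ∀ t ∈ Ioo (-(N + 1 : ℝ)) (N + 1), HasDerivAt a (v (a t)) t := by
    intro N
    have h0 : (0 : ℝ) ∈ Icc (-(N + 1 : ℝ)) (N + 1) := by
      constructor <;> linarith [N.cast_nonneg (α := ℝ)]
    -- A curve of speed at most `C` stays within distance `C (N + 1)` on this time interval, so a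
    -- ball of that radius suffices; the radius `0` fixes the single initial point.
    have hpl : IsPicardLindelof (fun _ => v) (tmin := -(N + 1 : ℝ)) (tmax := N + 1)
        ⟨0, h0⟩ x₀ (C.toNNReal * (N + 1)) 0 C.toNNReal k :=
      { lipschitzOnWith := fun t _ => hv.lipschitzOnWith
        continuousOn := fun x _ => continuousOn_const
        norm_le := fun t _ x _ => (hC x).trans (Real.le_coe_toNNReal C)
        mul_max_le := by simp }
    obtain ⟨a, ha0, ha⟩ := hpl.exists_eq_forall_mem_Icc_hasDerivWithinAt₀
    exact ⟨a, ha0, fun t ht => (ha t (Ioo_subset_Icc_self ht)).hasDerivAt (Icc_mem_nhds ht.1 ht.2)⟩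
  choose a ha0 ha using key
  have hmono : ∀ N M : ℕ, N ≤ M → EqOn (a N) (a M) (Ioo (-(N + 1 : ℝ)) (N + 1)) := by
    intro N M hNM
    have hNM' : (N : ℝ) ≤ M := by exact_mod_cast hNM
    have hN := N.cast_nonneg (α := ℝ)
    refine ODE_solution_unique_of_mem_Ioo (v := fun _ => v) (s := fun _ => univ) (t₀ := 0)
      (K := k) (fun t _ => hv.lipschitzOnWith) ⟨by linarith, by linarith⟩
      (fun t ht => ⟨ha N t ht, mem_univ _⟩)
      (fun t ht => ⟨ha M t ⟨by linarith [ht.1], by linarith [ht.2]⟩, mem_univ _⟩) ?_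
    rw [ha0, ha0]
  have hcons : ∀ (N M : ℕ) (s : ℝ), |s| < N + 1 → |s| < M + 1 → a N s = a M s := by
    intro N M s hN hM
    rcases le_total N M with h | h
    · exact hmono N M h (abs_lt.1 hN)
    · exact (hmono M N h (abs_lt.1 hM)).symm
  have hlt : ∀ s : ℝ, |s| < (⌈|s|⌉₊ : ℝ) + 1 := fun s => by linarith [Nat.le_ceil |s|]
  -- The index `⌈|t|⌉₊` puts `t` strictly inside the open interval of its curve, so near `t` the
  -- glued curve agrees with one fixed solution.
  refine ⟨fun t => a ⌈|t|⌉₊ t, by simpa using ha0 0, fun t => ?_⟩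
  refine (ha _ t (abs_lt.1 (hlt t))).congr_of_eventuallyEq ?_
  have : ∀ᶠ s in 𝓝 t, |s| < (⌈|t|⌉₊ : ℝ) + 1 :=
    continuous_abs.continuousAt.eventually_lt continuousAt_const (hlt t)
  filter_upwards [this] with s hs
  exact hcons _ _ s (hlt s) hs

/-- An integral curve of a smooth vector field is smooth. -/
theorem contDiff_integralCurve {E : Type*} [NormedAddCommGroup E] [NormedSpace ℝ E]
    {v : E → E} (hv : ContDiff ℝ ∞ v) {x : ℝ → E} (hx : ∀ t, HasDerivAt x (v (x t)) t) :
    ContDiff ℝ ∞ x := by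
  rw [contDiff_infty]
  intro n
  induction n with
  | zero =>
    exact contDiff_zero.2 (continuous_iff_continuousAt.2 fun t => (hx t).continuousAt)
  | succ n ih =>
    have hd : deriv x = v ∘ x := funext fun t => (hx t).deriv
    rw [Nat.cast_add, Nat.cast_one, contDiff_succ_iff_deriv]
    refine ⟨fun t => (hx t).differentiableAt, by simp, ?_⟩
    rw [hd]
    exact (hv.of_le (by exact_mod_cast le_top)).comp ih

variable {E : Type*} [NormedAddCommGroup E] [InnerProductSpace ℝ E] [CompleteSpace E]
  {U : Set E} {f : E → ℝ}

/-- Along a gradient flow the value of the function has derivative `-‖∇f‖²`. -/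
theorem hasDerivWithinAt_comp_gradientFlow (hf : ∀ x ∈ U, DifferentiableAt ℝ f x) {x : ℝ → E}
    (hxU : ∀ t, 0 ≤ t → x t ∈ U)
    (hx : ∀ t, 0 ≤ t → HasDerivWithinAt x (-gradient f (x t)) (Ici 0) t) {t : ℝ} (ht : 0 ≤ t) :
    HasDerivWithinAt (fun t => f (x t)) (-‖gradient f (x t)‖ ^ 2) (Ici 0) t := by
  have h := (hf _ (hxU t ht)).hasGradientAt.hasFDerivAt.comp_hasDerivWithinAt t (hx t ht)
  rwa [InnerProductSpace.toDual_apply_apply, inner_neg_right, real_inner_self_eq_norm_sq] at h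

theorem antitoneOn_of_hasDerivWithinAt_Ici {g g' : ℝ → ℝ}
    (hg : ∀ t, 0 ≤ t → HasDerivWithinAt g (g' t) (Ici 0) t) (hg' : ∀ t, 0 ≤ t → g' t ≤ 0) :
    AntitoneOn g (Ici 0) := by
  have hd : ∀ t ∈ interior (Ici (0 : ℝ)), HasDerivAt g (g' t) t := fun t ht => by
    rw [interior_Ici] at ht
    exact (hg t (le_of_lt ht)).hasDerivAt (Ici_mem_nhds ht)
  refine antitoneOn_of_deriv_nonpos (convex_Ici 0) (fun t ht => (hg t ht).continuousWithinAt)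
    (fun t ht => (hd t ht).differentiableAt.differentiableWithinAt) fun t ht => ?_
  rw [(hd t ht).deriv]
  exact hg' t (interior_subset ht)

theorem le_of_gradientFlow (hf : ∀ x ∈ U, DifferentiableAt ℝ f x) {x : ℝ → E}
    (hxU : ∀ t, 0 ≤ t → x t ∈ U)
    (hx : ∀ t, 0 ≤ t → HasDerivWithinAt x (-gradient f (x t)) (Ici 0) t) {t : ℝ} (ht : 0 ≤ t) :
    f (x t) ≤ f (x 0) :=
  antitoneOn_of_hasDerivWithinAt_Ici
    (fun _ hs => hasDerivWithinAt_comp_gradientFlow hf hxU hx hs)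
    (fun _ _ => neg_nonpos.2 (sq_nonneg _)) (mem_Ici.2 le_rfl) (mem_Ici.2 ht) ht

/-- Under a Polyak–Łojasiewicz inequality on a sublevel set the value of the function decays
exponentially along the gradient flow. -/
theorem gradientFlow_exp_decay (hf : ∀ x ∈ U, DifferentiableAt ℝ f x) {α c fmin : ℝ}
    (hPL : ∀ y ∈ U, f y ≤ c → α * (f y - fmin) ≤ ‖gradient f y‖ ^ 2) {x : ℝ → E}
    (hxU : ∀ t, 0 ≤ t → x t ∈ U) (hx0 : f (x 0) ≤ c)
    (hx : ∀ t, 0 ≤ t → HasDerivWithinAt x (-gradient f (x t)) (Ici 0) t) {t : ℝ} (ht : 0 ≤ t) :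
    f (x t) - fmin ≤ Real.exp (-α * t) * (f (x 0) - fmin) := by
  -- Grönwall by integrating factor: gradient dominance is exactly the nonpositivity of this
  -- derivative.
  have hd : ∀ s, 0 ≤ s → HasDerivWithinAt (fun s => Real.exp (α * s) * (f (x s) - fmin))
      (Real.exp (α * s) * (α * (f (x s) - fmin) - ‖gradient f (x s)‖ ^ 2)) (Ici 0) s := by
    intro s hs
    have h1 : HasDerivWithinAt (fun s => Real.exp (α * s)) (Real.exp (α * s) * α) (Ici 0) s := by
      simpa using ((hasDerivAt_id s).const_mul α).exp.hasDerivWithinAt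
    refine (h1.mul ((hasDerivWithinAt_comp_gradientFlow hf hxU hx hs).sub_const
      fmin)).congr_deriv ?_
    ring
  have := antitoneOn_of_hasDerivWithinAt_Ici hd (fun s hs => mul_nonpos_of_nonneg_of_nonpos
    (Real.exp_pos _).le (by
      linarith [hPL _ (hxU s hs) ((le_of_gradientFlow hf hxU hx hs).trans hx0)]))
    (mem_Ici.2 le_rfl) (mem_Ici.2 ht) ht
  simp only [mul_zero, Real.exp_zero, one_mul] at this
  rw [neg_mul, Real.exp_neg]
  rwa [← div_eq_inv_mul, le_div_iff₀' (Real.exp_pos _)]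

/-- Global existence, smoothness and uniqueness of the gradient flow of a smooth function on an
open set, started at a point whose sublevel set is compact. -/
theorem exists_gradientFlow_of_isCompact_sublevel [FiniteDimensional ℝ E] (hU : IsOpen U)
    (hf : ∀ x ∈ U, DifferentiableAt ℝ f x) (hG : ContDiffOn ℝ ∞ (gradient f) U)
    {x₀ : E} (hx₀ : x₀ ∈ U) (hS : IsCompact {x | x ∈ U ∧ f x ≤ f x₀}) :
    ∃ x : ℝ → E, x 0 = x₀ ∧ (∀ t, 0 ≤ t → x t ∈ U) ∧
      (∀ t, 0 ≤ t → HasDerivWithinAt x (-gradient f (x t)) (Ici 0) t) ∧ ContDiff ℝ ∞ x ∧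
      ∀ y : ℝ → E, y 0 = x₀ → (∀ t, 0 ≤ t → y t ∈ U) →
        (∀ t, 0 ≤ t → HasDerivWithinAt y (-gradient f (y t)) (Ici 0) t) → EqOn y x (Ici 0) := by
  set S : Set E := {x | x ∈ U ∧ f x ≤ f x₀} with hSdef
  obtain ⟨T, hTc, hST, hTU⟩ := exists_compact_between hS hU (fun x hx => hx.1)
  -- Cutting the field off between `S` and `T` makes it smooth with compact support, hence globally
  -- Lipschitz and bounded, without changing it on `S`.
  obtain ⟨χ, hχ1, hχ0, hχI⟩ := exists_contMDiffMap_one_nhds_of_subset_interior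
    (n := ⊤) (modelWithCornersSelf ℝ E) hS.isClosed hST
  have hχs : ContDiff ℝ ∞ χ := χ.contMDiff.contDiff
  have hχS : ∀ x ∈ S, χ x = 1 := fun x hx => hχ1.self_of_nhdsSet x hx
  set v : E → E := fun x => -(χ x • gradient f x) with hvdef
  have hv0 : ∀ x, x ∉ T → v x = 0 := fun x hx => by simp [hvdef, hχ0 x hx]
  have hvsupp : HasCompactSupport v := HasCompactSupport.intro hTc hv0
  have hvs : ContDiff ℝ ∞ v := by
    refine contDiff_iff_contDiffAt.2 fun x => ?_
    by_cases hx : x ∈ T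
    · have hxU : U ∈ 𝓝 x := hU.mem_nhds (hTU hx)
      exact (hχs.contDiffAt.smul (hG.contDiffAt hxU)).neg
    · refine (contDiffAt_const (c := (0 : E))).congr_of_eventuallyEq ?_
      filter_upwards [hTc.isClosed.isOpen_compl.mem_nhds hx] with y hy using hv0 y hy
  obtain ⟨k, hk⟩ := hvs.lipschitzWith_of_hasCompactSupport hvsupp (by simp)
  obtain ⟨C, hC⟩ := hvsupp.exists_bound_of_continuous hvs.continuous
  obtain ⟨x, hx0, hx⟩ := exists_integralCurve_of_lipschitz_of_bounded hk hC x₀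
  -- Outside `U` the truncated field vanishes, so a curve reaching such a point would be constant
  -- there, contrary to its start in `U`.
  have hxU : ∀ t, x t ∈ U := by
    intro t
    by_contra h
    have hvt : v (x t) = 0 := hv0 _ fun hT => h (hTU hT)
    have : x = fun _ => x t := ODE_solution_unique_univ (v := fun _ => v) (s := fun _ => univ)
      (t₀ := t) (K := k) (fun _ => hk.lipschitzOnWith) (fun s => ⟨hx s, mem_univ _⟩)
      (fun s => ⟨by simpa [hvt] using hasDerivAt_const s (x t), mem_univ _⟩) rfl
    have h0 := congrFun this 0
    simp only [hx0] at h0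
    exact h (h0 ▸ hx₀)
  have hdf : ∀ t, HasDerivAt (fun t => f (x t)) (-(χ (x t) * ‖gradient f (x t)‖ ^ 2)) t := by
    intro t
    have h := (hf _ (hxU t)).hasGradientAt.hasFDerivAt.comp_hasDerivAt t (hx t)
    rwa [InnerProductSpace.toDual_apply_apply, inner_neg_right, real_inner_smul_right,
      real_inner_self_eq_norm_sq] at h
  -- As `χ ≥ 0`, the truncated flow still decreases `f`; it therefore stays in `S`, where it is the
  -- true gradient flow.
  have hxS : ∀ t, 0 ≤ t → x t ∈ S := by
    intro t ht
    refine ⟨hxU t, ?_⟩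
    have := antitoneOn_of_hasDerivWithinAt_Ici (fun s _ => (hdf s).hasDerivWithinAt)
      (fun s _ => neg_nonpos.2 (mul_nonneg (hχI _).1 (sq_nonneg _)))
      (mem_Ici.2 le_rfl) (mem_Ici.2 ht) ht
    simpa [hx0] using this
  have hvS : ∀ y ∈ S, v y = -gradient f y := fun y hy => by simp [hvdef, hχS y hy]
  refine ⟨x, hx0, fun t _ => hxU t, fun t ht => ?_, contDiff_integralCurve hvs hx, ?_⟩
  · rw [← hvS _ (hxS t ht)]
    exact (hx t).hasDerivWithinAt
  · intro y hy0 hyU hy t ht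
    have hyS : ∀ s, 0 ≤ s → y s ∈ S := fun s hs =>
      ⟨hyU s hs, hy0 ▸ le_of_gradientFlow hf hyU hy hs⟩
    have ht' : t ∈ Icc 0 t := ⟨ht, le_rfl⟩
    refine ODE_solution_unique (v := fun _ => v) (K := k) (fun _ => hk)
      (fun s hs => (hy s hs.1).continuousWithinAt.mono fun r hr => hr.1)
      (fun s hs => ?_) (fun s _ => (hx s).continuousAt.continuousWithinAt)
      (fun s _ => (hx s).hasDerivWithinAt) (hy0.trans hx0.symm) ht'
    rw [hvS _ (hyS s hs.1)]
    exact (hy s hs.1).mono (Ici_subset_Ici.2 hs.1)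

end GradientFlow

/-! ### Decay of the exponential of a Hurwitz matrix -/

section MatrixExponential

open Filter Topology

attribute [local instance] Matrix.frobeniusNormedRing Matrix.frobeniusNormedAlgebra

/-- On a generalized eigenvector the exponential is an exponential polynomial. -/
theorem exp_smul_mulVec_of_pow_mulVec_eq_zero {n : ℕ} (M : Matrix (Fin n) (Fin n) ℂ) (μ : ℂ)
    (v : Fin n → ℂ) (k : ℕ) (hv : ((M - μ • 1) ^ k) *ᵥ v = 0) (t : ℝ) :
    NormedSpace.exp ((t : ℂ) • M) *ᵥ v = ∑ j ∈ Finset.range k,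
      (Complex.exp (t * μ) * (t : ℂ) ^ j) • (((j.factorial : ℂ)⁻¹) • ((M - μ • 1) ^ j *ᵥ v)) := by
  set N := M - μ • 1 with hN
  have hsplit : (t : ℂ) • M = ((t : ℂ) * μ) • (1 : Matrix (Fin n) (Fin n) ℂ) + (t : ℂ) • N := by
    rw [hN, smul_sub, smul_smul]; abel
  have hexp1 : NormedSpace.exp (((t : ℂ) * μ) • (1 : Matrix (Fin n) (Fin n) ℂ)) =
      Complex.exp (t * μ) • 1 := by
    rw [← Algebra.algebraMap_eq_smul_one, ← Algebra.algebraMap_eq_smul_one,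
      Complex.exp_eq_exp_ℂ]
    exact (NormedSpace.algebraMap_exp_comm _).symm
  have hcomm : Commute (((t : ℂ) * μ) • (1 : Matrix (Fin n) (Fin n) ℂ)) ((t : ℂ) • N) :=
    (Commute.one_left _).smul_left _
  have hsum := NormedSpace.exp_series_hasSum_exp' (𝕂 := ℂ) ((t : ℂ) • N)
  have hsumv : HasSum (fun j => ((j.factorial : ℂ)⁻¹ • ((t : ℂ) • N) ^ j) *ᵥ v)
      (NormedSpace.exp ((t : ℂ) • N) *ᵥ v) :=
    hsum.map (Matrix.mulVecBilin ℂ ℂ |>.flip v) (by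
      show Continuous fun A : Matrix (Fin n) (Fin n) ℂ => A *ᵥ v
      fun_prop)
  have hzero : ∀ j ∉ Finset.range k, ((j.factorial : ℂ)⁻¹ • ((t : ℂ) • N) ^ j) *ᵥ v = 0 := by
    intro j hj
    have hkj : k ≤ j := by simpa using hj
    obtain ⟨i, rfl⟩ := Nat.exists_eq_add_of_le' hkj
    rw [smul_pow, pow_add N]
    simp [Matrix.smul_mulVec, ← Matrix.mulVec_mulVec, hv]
  rw [hsplit, Matrix.exp_add_of_commute _ _ hcomm, hexp1, smul_mul_assoc, one_mul,
    Matrix.smul_mulVec, hsumv.unique (hasSum_sum_of_ne_finset_zero hzero), Finset.smul_sum]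
  refine Finset.sum_congr rfl fun j _ => ?_
  rw [smul_pow, Matrix.smul_mulVec, Matrix.smul_mulVec, mul_smul, smul_comm ((t : ℂ) ^ j)]

theorem tendsto_exp_mul_pow_zero {μ : ℂ} (hμ : μ.re < 0) (j : ℕ) :
    Tendsto (fun t : ℝ => Complex.exp (t * μ) * (t : ℂ) ^ j) atTop (𝓝 0) := by
  rw [tendsto_zero_iff_norm_tendsto_zero]
  have h := tendsto_rpow_mul_exp_neg_mul_atTop_nhds_zero j (-μ.re) (by linarith)
  refine h.congr' ?_
  filter_upwards [eventually_ge_atTop 0] with t ht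
  simp [Complex.norm_exp, Complex.mul_re, abs_of_nonneg ht, mul_comm]

/-- The generalized eigenspaces span the space, and on each of them the exponential is a finite sum
of terms e^{tμ} tʲ with Re μ < 0. -/
theorem tendsto_complex_exp_smul_mulVec {n : ℕ} {M : Matrix (Fin n) (Fin n) ℂ}
    (hM : ∀ μ ∈ spectrum ℂ M, μ.re < 0) (v : Fin n → ℂ) :
    Tendsto (fun t : ℝ => NormedSpace.exp ((t : ℂ) • M) *ᵥ v) atTop (𝓝 0) := by
  have hv : v ∈ ⨆ μ : ℂ, Module.End.maxGenEigenspace (Matrix.toLin' M) μ := by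
    rw [Module.End.iSup_maxGenEigenspace_eq_top]; trivial
  induction hv using Submodule.iSup_induction' with
  | mem μ w hw =>
    by_cases hw0 : w = 0
    · simp [hw0]
    have hμ : μ ∈ spectrum ℂ M := by
      rw [← Matrix.spectrum_toLin', ← Module.End.hasEigenvalue_iff_mem_spectrum]
      refine Module.End.hasEigenvalue_of_hasGenEigenvalue
        (k := Module.End.maxGenEigenspaceIndex (Matrix.toLin' M) μ) ?_
      rw [Module.End.HasGenEigenvalue, Module.End.HasUnifEigenvalue,
        ← Module.End.maxGenEigenspace_eq]
      exact fun h => hw0 (by simpa [h] using hw)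
    obtain ⟨k, hk⟩ := (Module.End.mem_maxGenEigenspace _ _ _).1 hw
    have hk' : ((M - μ • 1) ^ k) *ᵥ w = 0 := by
      rw [← Matrix.toLin'_apply, Matrix.toLin'_pow, map_sub, map_smul, Matrix.toLin'_one]
      exact hk
    simp_rw [exp_smul_mulVec_of_pow_mulVec_eq_zero M μ w k hk']
    rw [show (0 : Fin n → ℂ) = ∑ j ∈ Finset.range k,
      (0 : ℂ) • (((j.factorial : ℂ)⁻¹) • ((M - μ • 1) ^ j *ᵥ w)) by simp]
    exact tendsto_finsetSum _ fun j _ => (tendsto_exp_mul_pow_zero (hM μ hμ) j).smul_const _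
  | zero => simp
  | add x y _ _ hx hy =>
    simpa [Matrix.mulVec_add] using hx.add hy

/-- The exponential of a Hurwitz matrix decays. -/
theorem IsHurwitz.tendsto_exp {n : ℕ} {M : Matrix (Fin n) (Fin n) ℝ} (hM : IsHurwitz M) :
    Tendsto (fun t : ℝ => NormedSpace.exp (t • M)) atTop (𝓝 0) := by
  have hmap : ∀ t : ℝ, (NormedSpace.exp (t • M)).map (algebraMap ℝ ℂ) =
      NormedSpace.exp ((t : ℂ) • M.map (algebraMap ℝ ℂ)) := by
    intro t
    have h := NormedSpace.map_exp (algebraMap ℝ ℂ).mapMatrix (by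
      show Continuous fun A : Matrix (Fin n) (Fin n) ℝ => A.map (algebraMap ℝ ℂ)
      exact continuous_id.matrix_map Complex.continuous_ofReal) (t • M)
    rw [RingHom.mapMatrix_apply, RingHom.mapMatrix_apply] at h
    refine h.trans (congrArg _ ?_)
    ext i j
    simp
  -- Each real entry is the real part of a coordinate of the complex exponential applied to a basis
  -- vector.
  refine tendsto_pi_nhds.2 fun i => tendsto_pi_nhds.2 fun j => ?_
  have h := (tendsto_pi_nhds.1 (tendsto_complex_exp_smul_mulVec hM (Pi.single j 1))) i
  simp_rw [← hmap] at h
  have h2 := (Complex.continuous_re.tendsto 0).comp h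
  simpa [Function.comp_def] using h2

end MatrixExponential

/-! ### Lyapunov equations -/

section Lyapunov

open Filter Topology

theorem spectrum_map_transpose {n : ℕ} (M : Matrix (Fin n) (Fin n) ℝ) :
    spectrum ℂ (Mᵀ.map (algebraMap ℝ ℂ)) = spectrum ℂ (M.map (algebraMap ℝ ℂ)) := by
  ext μ
  rw [Matrix.mem_spectrum_iff_isRoot_charpoly, Matrix.mem_spectrum_iff_isRoot_charpoly,
    Matrix.transpose_map, Matrix.charpoly_transpose]

theorem IsHurwitz.transpose {n : ℕ} {M : Matrix (Fin n) (Fin n) ℝ} (hM : IsHurwitz M) :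
    IsHurwitz Mᵀ := by
  intro μ hμ
  rw [spectrum_map_transpose] at hμ
  exact hM μ hμ

/-- Real and imaginary parts of an eigenvector equation for a real matrix. -/
theorem re_im_of_map_mulVec_eq_smul {n : ℕ} {M : Matrix (Fin n) (Fin n) ℝ} {μ : ℂ}
    {v w : Fin n → ℂ} (h : M.map (algebraMap ℝ ℂ) *ᵥ v = μ • w) :
    M *ᵥ (fun i => (v i).re) = μ.re • (fun i => (w i).re) - μ.im • (fun i => (w i).im) ∧
    M *ᵥ (fun i => (v i).im) = μ.im • (fun i => (w i).re) + μ.re • (fun i => (w i).im) := by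
  constructor
  · ext i
    have := congrArg Complex.re (congrFun h i)
    simpa [Matrix.mulVec, dotProduct] using this
  · ext i
    have := congrArg Complex.im (congrFun h i)
    simp [Matrix.mulVec, dotProduct] at this ⊢
    linarith

theorem dotProduct_mulVec_comm_of_transpose_eq {n : ℕ} {X : Matrix (Fin n) (Fin n) ℝ}
    (hX : Xᵀ = X) (a b : Fin n → ℝ) : a ⬝ᵥ (X *ᵥ b) = b ⬝ᵥ (X *ᵥ a) := by
  rw [Matrix.dotProduct_mulVec, ← Matrix.mulVec_transpose, hX, dotProduct_comm]

theorem dotProduct_lyapunov {n : ℕ} {M X : Matrix (Fin n) (Fin n) ℝ} (hX : Xᵀ = X)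
    (w : Fin n → ℝ) : w ⬝ᵥ ((M * X + X * Mᵀ) *ᵥ w) = 2 * ((Mᵀ *ᵥ w) ⬝ᵥ (X *ᵥ w)) := by
  rw [Matrix.add_mulVec, dotProduct_add, ← Matrix.mulVec_mulVec, ← Matrix.mulVec_mulVec,
    dotProduct_mulVec_comm_of_transpose_eq hX w, Matrix.dotProduct_mulVec w M,
    ← Matrix.mulVec_transpose]
  ring

/-- Lyapunov's criterion for Hurwitz stability. -/
theorem isHurwitz_of_lyapunov {n : ℕ} {M X : Matrix (Fin n) (Fin n) ℝ} (hX : X.PosSemidef)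
    (h : ∀ w, w ≠ 0 → w ⬝ᵥ ((M * X + X * Mᵀ) *ᵥ w) < 0) : IsHurwitz M := by
  have hXt : Xᵀ = X := hX.isHermitian.eq
  intro μ hμ
  rw [← spectrum_map_transpose, ← Matrix.spectrum_toLin',
    ← Module.End.hasEigenvalue_iff_mem_spectrum] at hμ
  obtain ⟨v, hv⟩ := hμ.exists_hasEigenvector
  have hv' : Mᵀ.map (algebraMap ℝ ℂ) *ᵥ v = μ • v := hv.apply_eq_smul
  obtain ⟨ha, hb⟩ := re_im_of_map_mulVec_eq_smul hv'
  set a : Fin n → ℝ := fun i => (v i).re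
  set b : Fin n → ℝ := fun i => (v i).im
  have hle : ∀ w, w ⬝ᵥ ((M * X + X * Mᵀ) *ᵥ w) ≤ 0 := fun w => by
    by_cases hw : w = 0
    · simp [hw]
    · exact (h w hw).le
  have hlt : a ⬝ᵥ ((M * X + X * Mᵀ) *ᵥ a) + b ⬝ᵥ ((M * X + X * Mᵀ) *ᵥ b) < 0 := by
    by_cases ha0 : a = 0
    · have hb0 : b ≠ 0 := fun hb0 => hv.2 <| funext fun i =>
        Complex.ext (congrFun ha0 i) (congrFun hb0 i)
      linarith [hle a, h b hb0]
    · linarith [h a ha0, hle b]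
  -- For an eigenvector a + ib of `Mᵀ` the cross terms cancel by symmetry of `X`, and the sum is 2
  -- Re μ (aᵀXa + bᵀXb). This being negative forces Re μ < 0, even with `X` only semidefinite.
  rw [dotProduct_lyapunov hXt, dotProduct_lyapunov hXt, ha, hb] at hlt
  simp only [sub_dotProduct, add_dotProduct, smul_dotProduct, smul_eq_mul] at hlt
  rw [dotProduct_mulVec_comm_of_transpose_eq hXt b a] at hlt
  have hpa : 0 ≤ a ⬝ᵥ (X *ᵥ a) := by simpa using hX.dotProduct_mulVec_nonneg a
  have hpb : 0 ≤ b ⬝ᵥ (X *ᵥ b) := by simpa using hX.dotProduct_mulVec_nonneg b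
  by_contra hμ
  push Not at hμ
  nlinarith [mul_nonneg hμ hpa, mul_nonneg hμ hpb]

section

attribute [local instance] Matrix.frobeniusNormedRing Matrix.frobeniusNormedAlgebra

/-- The Lyapunov operator generates the flow X ↦ e^{tM} X e^{tMᵀ}. For Hurwitz `M` this flow decays,
so properties of Lyapunov solutions follow by letting t tend to infinity. -/
theorem hasDerivAt_exp_mul_mul_exp_transpose {n : ℕ} (M X : Matrix (Fin n) (Fin n) ℝ) (t : ℝ) :
    HasDerivAt (fun t : ℝ => NormedSpace.exp (t • M) * X * (NormedSpace.exp (t • M))ᵀ)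
      (NormedSpace.exp (t • M) * (M * X + X * Mᵀ) * (NormedSpace.exp (t • M))ᵀ) t := by
  have h1 : HasDerivAt (fun t : ℝ => NormedSpace.exp (t • M)) (NormedSpace.exp (t • M) * M) t :=
    hasDerivAt_exp_smul_const M t
  have h2 : HasDerivAt (fun t : ℝ => NormedSpace.exp (t • Mᵀ))
    (Mᵀ * NormedSpace.exp (t • Mᵀ)) t := hasDerivAt_exp_smul_const' Mᵀ t
  have ht : ∀ t : ℝ, (NormedSpace.exp (t • M))ᵀ = NormedSpace.exp (t • Mᵀ) := fun t => by
    rw [← Matrix.exp_transpose, Matrix.transpose_smul]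
  simp_rw [ht]
  refine ((h1.mul_const X).mul h2).congr_deriv ?_
  simp only [mul_add, add_mul, mul_assoc]

theorem IsHurwitz.tendsto_exp_mul_mul_exp_transpose {n : ℕ} {M : Matrix (Fin n) (Fin n) ℝ}
    (hM : IsHurwitz M) (X : Matrix (Fin n) (Fin n) ℝ) :
    Tendsto (fun t : ℝ => NormedSpace.exp (t • M) * X * (NormedSpace.exp (t • M))ᵀ) atTop
      (𝓝 0) := by
  have h := (hM.tendsto_exp.mul_const X).mul
    ((continuous_id.matrix_transpose.tendsto (0 : Matrix (Fin n) (Fin n) ℝ)).comp hM.tendsto_exp)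
  simpa [Function.comp_def] using h

end

theorem hasDerivAt_dotProduct_exp {n : ℕ} (M X : Matrix (Fin n) (Fin n) ℝ) (w : Fin n → ℝ)
    (t : ℝ) :
    HasDerivAt (fun t : ℝ => ((NormedSpace.exp (t • M))ᵀ *ᵥ w) ⬝ᵥ
        (X *ᵥ ((NormedSpace.exp (t • M))ᵀ *ᵥ w)))
      (((NormedSpace.exp (t • M))ᵀ *ᵥ w) ⬝ᵥ
        ((M * X + X * Mᵀ) *ᵥ ((NormedSpace.exp (t • M))ᵀ *ᵥ w))) t := by
  have key : ∀ (Z : Matrix (Fin n) (Fin n) ℝ) (t : ℝ), ((NormedSpace.exp (t • M))ᵀ *ᵥ w) ⬝ᵥ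
      (Z *ᵥ ((NormedSpace.exp (t • M))ᵀ *ᵥ w)) =
      w ⬝ᵥ ((NormedSpace.exp (t • M) * Z * (NormedSpace.exp (t • M))ᵀ) *ᵥ w) := by
    intro Z t
    rw [← Matrix.mulVec_mulVec, ← Matrix.mulVec_mulVec, Matrix.dotProduct_mulVec w,
      ← Matrix.mulVec_transpose]
  simp_rw [key]
  let φ : Matrix (Fin n) (Fin n) ℝ →ₗ[ℝ] ℝ :=
    { toFun := fun Z => w ⬝ᵥ (Z *ᵥ w)
      map_add' := fun Y Z => by rw [Matrix.add_mulVec, dotProduct_add]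
      map_smul' := fun c Z => by rw [Matrix.smul_mulVec, dotProduct_smul]; rfl }
  exact φ.toContinuousLinearMap.hasFDerivAt.comp_hasDerivAt t
    (hasDerivAt_exp_mul_mul_exp_transpose M X t)

theorem IsHurwitz.tendsto_dotProduct_exp {n : ℕ} {M : Matrix (Fin n) (Fin n) ℝ}
    (hM : IsHurwitz M) (X : Matrix (Fin n) (Fin n) ℝ) (w : Fin n → ℝ) :
    Tendsto (fun t : ℝ => ((NormedSpace.exp (t • M))ᵀ *ᵥ w) ⬝ᵥ
        (X *ᵥ ((NormedSpace.exp (t • M))ᵀ *ᵥ w))) atTop (𝓝 0) := by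
  have hc : Continuous fun Z : Matrix (Fin n) (Fin n) ℝ => (Zᵀ *ᵥ w) ⬝ᵥ (X *ᵥ (Zᵀ *ᵥ w)) := by
    fun_prop
  simpa [Function.comp_def] using (hc.tendsto 0).comp hM.tendsto_exp

/-- A Hurwitz matrix has an injective Lyapunov operator. -/
theorem IsHurwitz.eq_zero_of_lyapunov {n : ℕ} {M X : Matrix (Fin n) (Fin n) ℝ}
    (hM : IsHurwitz M) (h : M * X + X * Mᵀ = 0) : X = 0 := by
  set G : ℝ → Matrix (Fin n) (Fin n) ℝ :=
    fun t => NormedSpace.exp (t • M) * X * (NormedSpace.exp (t • M))ᵀ with hG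
  have hd : ∀ t, HasDerivAt G 0 t := fun t => by
    simpa [h] using hasDerivAt_exp_mul_mul_exp_transpose M X t
  have hconst : ∀ t, G t = G 0 := fun t =>
    is_const_of_deriv_eq_zero (fun t => (hd t).differentiableAt) (fun t => (hd t).deriv) t 0
  have h0 : G 0 = X := by simp [hG]
  have hlim : Tendsto G atTop (𝓝 0) := hM.tendsto_exp_mul_mul_exp_transpose X
  rw [show G = fun _ => X from funext fun t => (hconst t).trans h0] at hlim
  exact tendsto_nhds_unique tendsto_const_nhds hlim

/-- Symmetry holds because X - Xᵀ solves the homogeneous equation. Along e^{tMᵀ}w the quadratic form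
of `X` is nonincreasing and tends to 0, so it is nonnegative at t = 0. -/
theorem IsHurwitz.posSemidef_of_lyapunov {n : ℕ} {M X S : Matrix (Fin n) (Fin n) ℝ}
    (hM : IsHurwitz M) (hS : S.PosSemidef) (h : M * X + X * Mᵀ = -S) : X.PosSemidef := by
  have hSt : Sᵀ = S := hS.isHermitian.eq
  have hXt : Xᵀ = X := by
    refine sub_eq_zero.1 (hM.eq_zero_of_lyapunov ?_)
    have h' := congrArg Matrix.transpose h
    simp only [Matrix.transpose_add, Matrix.transpose_mul, Matrix.transpose_neg,
      Matrix.transpose_transpose, hSt] at h'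
    rw [mul_sub, sub_mul, sub_add_sub_comm, h, add_comm, h', sub_self]
  refine Matrix.PosSemidef.of_dotProduct_mulVec_nonneg hXt fun w => ?_
  have hanti : Antitone fun t : ℝ => ((NormedSpace.exp (t • M))ᵀ *ᵥ w) ⬝ᵥ
        (X *ᵥ ((NormedSpace.exp (t • M))ᵀ *ᵥ w)) := by
    refine antitone_of_hasDerivAt_nonpos (fun t => hasDerivAt_dotProduct_exp M X w t) fun t => ?_
    rw [h, Matrix.neg_mulVec, dotProduct_neg]
    exact neg_nonpos.2 (hS.dotProduct_mulVec_nonneg _)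
  have := hanti.le_of_tendsto (hM.tendsto_dotProduct_exp X w) 0
  simpa using this

/-- If wᵀXw = 0 then Xw = 0 by semidefiniteness, and the Lyapunov equation tested on w gives wᵀSw =
0. -/
theorem IsHurwitz.posDef_of_lyapunov {n : ℕ} {M X S : Matrix (Fin n) (Fin n) ℝ}
    (hM : IsHurwitz M) (hS : S.PosDef) (h : M * X + X * Mᵀ = -S) : X.PosDef := by
  have hX := hM.posSemidef_of_lyapunov hS.posSemidef h
  have hXt : Xᵀ = X := hX.isHermitian.eq
  refine Matrix.PosDef.of_dotProduct_mulVec_pos hX.isHermitian fun w hw => ?_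
  refine lt_of_le_of_ne (hX.dotProduct_mulVec_nonneg w) fun h0 => ?_
  have hXw := (hX.dotProduct_mulVec_zero_iff w).1 h0.symm
  have h1 := dotProduct_lyapunov (M := M) hXt w
  rw [h, hXw, dotProduct_zero, mul_zero, Matrix.neg_mulVec, dotProduct_neg] at h1
  have h2 := hS.dotProduct_mulVec_pos hw
  simp only [star_trivial] at h2
  linarith

/-- The solution `x` of `L x = s` for an injective endomorphism `L` of a finite-dimensional
normed space. -/
noncomputable def linearSolve {E : Type*} [NormedAddCommGroup E] [NormedSpace ℝ E]
    [FiniteDimensional ℝ E] (L : E →ₗ[ℝ] E) (s : E) : E :=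
  L.toContinuousLinearMap.inverse s

section LinearSolve

variable {E V : Type*} [NormedAddCommGroup E] [NormedSpace ℝ E] [FiniteDimensional ℝ E]
  [NormedAddCommGroup V] [NormedSpace ℝ V] [FiniteDimensional ℝ V]

theorem exists_equiv_toContinuousLinearMap {L : E →ₗ[ℝ] E} (hL : Function.Injective L) :
    ∃ e : E ≃L[ℝ] E, (e : E →L[ℝ] E) = L.toContinuousLinearMap :=
  ⟨(LinearEquiv.ofInjectiveEndo L hL).toContinuousLinearEquiv, by ext1 x; rfl⟩

theorem apply_linearSolve {L : E →ₗ[ℝ] E} (hL : Function.Injective L) (s : E) :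
    L (linearSolve L s) = s := by
  obtain ⟨e, he⟩ := exists_equiv_toContinuousLinearMap hL
  change L.toContinuousLinearMap (L.toContinuousLinearMap.inverse s) = s
  rw [← he, ContinuousLinearMap.inverse_equiv]
  exact e.apply_symm_apply s

/-- Inversion of operators is smooth at invertible ones, and the operator depends linearly on `M`.
This gives smoothness of Lyapunov solutions in the gain without an integral formula. -/
theorem contDiffAt_linearSolve {F : Type*} [NormedAddCommGroup F] [NormedSpace ℝ F]
    (L : V →ₗ[ℝ] E →ₗ[ℝ] E) {M : F → V} {s : F → E} {x : F} {k : WithTop ℕ∞}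
    (hM : ContDiffAt ℝ k M x) (hs : ContDiffAt ℝ k s x) (hL : Function.Injective (L (M x))) :
    ContDiffAt ℝ k (fun y => linearSolve (L (M y)) (s y)) x := by
  have := FiniteDimensional.complete ℝ E
  obtain ⟨e, he⟩ := exists_equiv_toContinuousLinearMap hL
  let Λ : V →ₗ[ℝ] (E →L[ℝ] E) :=
    (LinearMap.toContinuousLinearMap (𝕜 := ℝ) (E := E) (F' := E)).toLinearMap ∘ₗ L
  have h1 : ContDiffAt ℝ k (fun y => (L (M y)).toContinuousLinearMap) x :=
    Λ.toContinuousLinearMap.contDiff.contDiffAt.comp x hM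
  have h2 : ContDiffAt ℝ k (fun y => (L (M y)).toContinuousLinearMap.inverse) x := by
    refine ContDiffAt.comp (g := ContinuousLinearMap.inverse (R := ℝ) (M := E) (M₂ := E)) x ?_ h1
    rw [← he]
    exact contDiffAt_map_inverse e
  exact h2.clm_apply hs

end LinearSolve

/-- The Lyapunov operator `X ↦ M X + X Mᵀ`, as a linear function of `M`. -/
def lyapunovOp (n : ℕ) : Matrix (Fin n) (Fin n) ℝ →ₗ[ℝ]
    (Matrix (Fin n) (Fin n) ℝ →ₗ[ℝ] Matrix (Fin n) (Fin n) ℝ) :=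
  LinearMap.mk₂ ℝ (fun M X => M * X + X * Mᵀ)
    (fun M N X => by rw [Matrix.transpose_add, add_mul, mul_add]; abel)
    (fun c M X => by simp)
    (fun M X Y => by rw [add_mul, mul_add]; abel)
    (fun c M X => by simp)

/-- The solution `X` of the Lyapunov equation `M X + X Mᵀ = -S`. -/
noncomputable def lyapunovSol {n : ℕ} (M S : Matrix (Fin n) (Fin n) ℝ) :
    Matrix (Fin n) (Fin n) ℝ :=
  linearSolve (lyapunovOp n M) (-S)

theorem IsHurwitz.lyapunovOp_injective {n : ℕ} {M : Matrix (Fin n) (Fin n) ℝ}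
    (hM : IsHurwitz M) : Function.Injective (lyapunovOp n M) :=
  (injective_iff_map_eq_zero _).2 fun _ hX => hM.eq_zero_of_lyapunov hX

theorem IsHurwitz.lyapunovSol_spec {n : ℕ} {M : Matrix (Fin n) (Fin n) ℝ} (hM : IsHurwitz M)
    (S : Matrix (Fin n) (Fin n) ℝ) : M * lyapunovSol M S + lyapunovSol M S * Mᵀ = -S :=
  apply_linearSolve hM.lyapunovOp_injective (-S)

theorem contDiffAt_lyapunovSol {n : ℕ} {E : Type*} [NormedAddCommGroup E] [NormedSpace ℝ E]
    {M S : E → Matrix (Fin n) (Fin n) ℝ} {x : E} {k : WithTop ℕ∞} (hM : ContDiffAt ℝ k M x)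
    (hS : ContDiffAt ℝ k S x) (h : IsHurwitz (M x)) :
    ContDiffAt ℝ k (fun y => lyapunovSol (M y) (S y)) x :=
  contDiffAt_linearSolve (lyapunovOp n) hM hS.neg h.lyapunovOp_injective

end Lyapunov

/-! ### Trace estimates for the Frobenius inner product -/

section FrobeniusInner

open scoped RealInnerProductSpace

theorem frobenius_inner_def {m n : ℕ} (M N : Matrix (Fin m) (Fin n) ℝ) :
    ⟪M, N⟫ = (Mᵀ * N).trace := rfl

theorem frobenius_inner_mul_right {k m n : ℕ} (M : Matrix (Fin m) (Fin k) ℝ)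
    (X : Matrix (Fin k) (Fin n) ℝ) (N : Matrix (Fin m) (Fin n) ℝ) :
    ⟪M * X, N⟫ = ⟪M, N * Xᵀ⟫ := by
  rw [frobenius_inner_def, frobenius_inner_def, Matrix.transpose_mul, Matrix.mul_assoc,
    Matrix.trace_mul_comm, Matrix.mul_assoc]

theorem frobenius_inner_transpose {m n : ℕ} (M N : Matrix (Fin m) (Fin n) ℝ) :
    ⟪Mᵀ, Nᵀ⟫ = ⟪M, N⟫ := by
  rw [frobenius_inner_def, frobenius_inner_def, Matrix.transpose_transpose,
    Matrix.trace_mul_comm, ← Matrix.trace_transpose, Matrix.transpose_mul,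
    Matrix.transpose_transpose]

theorem frobenius_inner_mul_self_eq_sum {m n : ℕ} (M : Matrix (Fin m) (Fin n) ℝ)
    (X : Matrix (Fin n) (Fin n) ℝ) : ⟪M * X, M⟫ = ∑ i, M i ⬝ᵥ (X *ᵥ M i) := by
  rw [frobenius_inner_mul_right, frobenius_inner_def, Matrix.trace_mul_comm]
  simp only [Matrix.trace, Matrix.diag, Matrix.mul_apply, Matrix.transpose_apply, dotProduct,
    Matrix.mulVec]
  refine Finset.sum_congr rfl fun i _ => Finset.sum_congr rfl fun j _ => ?_
  rw [mul_comm]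
  exact congrArg _ (Finset.sum_congr rfl fun k _ => mul_comm _ _)

theorem le_frobenius_inner_mul_self {m n : ℕ} {X : Matrix (Fin n) (Fin n) ℝ} {a : ℝ}
    (h : ∀ w, a * (w ⬝ᵥ w) ≤ w ⬝ᵥ (X *ᵥ w)) (M : Matrix (Fin m) (Fin n) ℝ) :
    a * ‖M‖ ^ 2 ≤ ⟪M * X, M⟫ := by
  have h1 := frobenius_inner_mul_self_eq_sum M 1
  rw [Matrix.mul_one, real_inner_self_eq_norm_sq] at h1
  rw [h1, frobenius_inner_mul_self_eq_sum, Finset.mul_sum]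
  exact Finset.sum_le_sum fun i _ => by simpa using h (M i)

theorem le_frobenius_inner_self_mul {m n : ℕ} {R : Matrix (Fin m) (Fin m) ℝ} {r : ℝ}
    (hRt : Rᵀ = R) (h : ∀ w, r * (w ⬝ᵥ w) ≤ w ⬝ᵥ (R *ᵥ w)) (M : Matrix (Fin m) (Fin n) ℝ) :
    r * ‖M‖ ^ 2 ≤ ⟪R * M, M⟫ := by
  have := le_frobenius_inner_mul_self h Mᵀ
  rwa [Matrix.frobenius_norm_transpose, ← frobenius_inner_transpose, Matrix.transpose_mul, hRt,
    Matrix.transpose_transpose] at this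

theorem exists_eq_transpose_mul_self {n : ℕ} {X : Matrix (Fin n) (Fin n) ℝ}
    (hX : X.PosSemidef) : ∃ C : Matrix (Fin n) (Fin n) ℝ, X = Cᵀ * C := by
  open scoped MatrixOrder in
  obtain ⟨C, hC⟩ := CStarAlgebra.nonneg_iff_eq_star_mul_self.mp hX.nonneg
  exact ⟨C, by simpa [Matrix.star_eq_conjTranspose] using hC⟩

/-- With X = CᵀC the form becomes ⟪R(MCᵀ), MCᵀ⟫, at least r‖MCᵀ‖² = r⟪MX, M⟫, so the two lower
bounds apply one after the other. -/
theorem le_frobenius_inner_mul_mul {m n : ℕ} {R : Matrix (Fin m) (Fin m) ℝ}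
    {X : Matrix (Fin n) (Fin n) ℝ} (hX : X.PosSemidef) {r a : ℝ} (hr : 0 ≤ r) (hRt : Rᵀ = R)
    (hR : ∀ w, r * (w ⬝ᵥ w) ≤ w ⬝ᵥ (R *ᵥ w)) (ha : ∀ w, a * (w ⬝ᵥ w) ≤ w ⬝ᵥ (X *ᵥ w))
    (M : Matrix (Fin m) (Fin n) ℝ) : r * a * ‖M‖ ^ 2 ≤ ⟪R * M * X, M⟫ := by
  obtain ⟨C, hC⟩ := exists_eq_transpose_mul_self hX
  have h1 : ⟪R * M * X, M⟫ = ⟪R * (M * Cᵀ), M * Cᵀ⟫ := by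
    rw [hC, ← Matrix.mul_assoc, frobenius_inner_mul_right, Matrix.mul_assoc]
  have h2 : ⟪M * X, M⟫ = ‖M * Cᵀ‖ ^ 2 := by
    rw [hC, ← Matrix.mul_assoc, frobenius_inner_mul_right, real_inner_self_eq_norm_sq]
  have h3 := le_frobenius_inner_self_mul hRt hR (M * Cᵀ)
  have h4 := le_frobenius_inner_mul_self ha M
  rw [h1]
  rw [h2] at h4
  nlinarith [mul_le_mul_of_nonneg_left h4 hr]

theorem frobenius_inner_mul_mul_le {m n : ℕ} (R : Matrix (Fin m) (Fin m) ℝ)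
    (X : Matrix (Fin n) (Fin n) ℝ) (M : Matrix (Fin m) (Fin n) ℝ) :
    ⟪R * M * X, M⟫ ≤ ‖R‖ * ‖X‖ * ‖M‖ ^ 2 := by
  calc ⟪R * M * X, M⟫ ≤ ‖R * M * X‖ * ‖M‖ := real_inner_le_norm _ _
    _ ≤ (‖R‖ * ‖M‖ * ‖X‖) * ‖M‖ := by
        gcongr
        exact (Matrix.frobenius_norm_mul _ _).trans
          (mul_le_mul_of_nonneg_right (Matrix.frobenius_norm_mul _ _) (norm_nonneg _))
    _ = ‖R‖ * ‖X‖ * ‖M‖ ^ 2 := by ring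

/-- Cauchy–Schwarz against the rank-one matrix wwᵀ, whose Frobenius norm is wᵀw. -/
theorem abs_dotProduct_mulVec_le {n : ℕ} (M : Matrix (Fin n) (Fin n) ℝ) (w : Fin n → ℝ) :
    |w ⬝ᵥ (M *ᵥ w)| ≤ ‖M‖ * (w ⬝ᵥ w) := by
  have h1 : ∀ N : Matrix (Fin n) (Fin n) ℝ, ⟪N, Matrix.vecMulVec w w⟫ = w ⬝ᵥ (N *ᵥ w) := by
    intro N
    rw [frobenius_inner_def, Matrix.mul_vecMulVec, Matrix.trace_vecMulVec,
      Matrix.mulVec_transpose, ← Matrix.dotProduct_mulVec]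
  have hw : 0 ≤ w ⬝ᵥ w := by simpa using dotProduct_star_self_nonneg w
  have h2 : ‖Matrix.vecMulVec w w‖ = w ⬝ᵥ w := by
    rw [← sq_eq_sq₀ (norm_nonneg _) hw, ← real_inner_self_eq_norm_sq, h1,
      Matrix.vecMulVec_mulVec]
    simp [sq]
  rw [← h1, ← h2]
  exact abs_real_inner_le_norm _ _

/-- A positive definite matrix is bounded below by a positive multiple of the identity. -/
theorem Matrix.PosDef.exists_pos_le {n : ℕ} {X : Matrix (Fin n) (Fin n) ℝ} (hX : X.PosDef) :
    ∃ a > 0, ∀ w, a * (w ⬝ᵥ w) ≤ w ⬝ᵥ (X *ᵥ w) := by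
  obtain ⟨C, hC⟩ := exists_eq_transpose_mul_self hX.posSemidef
  have hu : IsUnit C.det := by
    have := hX.det_pos
    rw [hC, Matrix.det_mul, Matrix.det_transpose] at this
    exact isUnit_iff_ne_zero.2 fun h => by simp [h] at this
  have hinv : (C⁻¹ * C) = 1 := Matrix.nonsing_inv_mul C hu
  -- Writing w = C⁻¹(Cw) bounds wᵀw by ‖C⁻ᵀC⁻¹‖ wᵀXw. The summand 1 keeps the denominator positive
  -- when n = 0.
  refine ⟨1 / (‖(C⁻¹)ᵀ * C⁻¹‖ + 1), by positivity, fun w => ?_⟩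
  have h1 := (abs_le.1 (abs_dotProduct_mulVec_le ((C⁻¹)ᵀ * C⁻¹) (C *ᵥ w))).2
  have h2 : (C *ᵥ w) ⬝ᵥ (((C⁻¹)ᵀ * C⁻¹) *ᵥ (C *ᵥ w)) = w ⬝ᵥ w := by
    rw [← Matrix.mulVec_mulVec, Matrix.dotProduct_mulVec, ← Matrix.mulVec_transpose,
      Matrix.transpose_transpose, Matrix.mulVec_mulVec, hinv, Matrix.one_mulVec]
  have h3 : (C *ᵥ w) ⬝ᵥ (C *ᵥ w) = w ⬝ᵥ (X *ᵥ w) := by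
    rw [hC, ← Matrix.mulVec_mulVec, Matrix.dotProduct_mulVec w, ← Matrix.mulVec_transpose,
      Matrix.transpose_transpose]
  have h4 : 0 ≤ w ⬝ᵥ (X *ᵥ w) := by simpa using hX.posSemidef.dotProduct_mulVec_nonneg w
  rw [h2, h3] at h1
  rw [one_div, inv_mul_le_iff₀ (by positivity)]
  linarith

end FrobeniusInner

/-! ### The cost through Lyapunov equations, and its gradient -/

section LQR

open Filter Topology
open scoped RealInnerProductSpace

/-- The second moment `∑ⱼ x₀ʲ (x₀ʲ)ᵀ` of the initial conditions. -/
def initialMoment {n : ℕ} (x₀ : Fin n → Fin n → ℝ) : Matrix (Fin n) (Fin n) ℝ :=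
  ∑ j, Matrix.vecMulVec (x₀ j) (x₀ j)

theorem dotProduct_initialMoment {n : ℕ} (x₀ : Fin n → Fin n → ℝ) (w : Fin n → ℝ) :
    w ⬝ᵥ (initialMoment x₀ *ᵥ w) = ∑ j, (x₀ j ⬝ᵥ w) ^ 2 := by
  rw [initialMoment, Matrix.sum_mulVec, dotProduct_sum]
  refine Finset.sum_congr rfl fun j _ => ?_
  rw [Matrix.vecMulVec_mulVec, dotProduct_comm]
  simp [sq]

theorem initialMoment_posSemidef {n : ℕ} (x₀ : Fin n → Fin n → ℝ) :
    (initialMoment x₀).PosSemidef := by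
  have hsym : (initialMoment x₀)ᵀ = initialMoment x₀ := by
    simp [initialMoment, Matrix.transpose_sum, Matrix.transpose_vecMulVec]
  refine Matrix.PosSemidef.of_dotProduct_mulVec_nonneg hsym fun w => ?_
  rw [star_trivial, dotProduct_initialMoment]
  exact Finset.sum_nonneg fun j _ => sq_nonneg _

theorem initialMoment_posDef {n : ℕ} {x₀ : Fin n → Fin n → ℝ}
    (hx₀ : Submodule.span ℝ (Set.range x₀) = ⊤) : (initialMoment x₀).PosDef := by
  refine Matrix.PosDef.of_dotProduct_mulVec_pos (initialMoment_posSemidef x₀).isHermitian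
    fun w hw => ?_
  rw [star_trivial, dotProduct_initialMoment]
  refine lt_of_le_of_ne (Finset.sum_nonneg fun j _ => sq_nonneg _) fun h => hw ?_
  have h0 := (Finset.sum_eq_zero_iff_of_nonneg fun j _ => sq_nonneg (x₀ j ⬝ᵥ w)).1 h.symm
  have hspan : ∀ v ∈ Submodule.span ℝ (Set.range x₀), v ⬝ᵥ w = 0 := by
    intro v hv
    induction hv using Submodule.span_induction with
    | mem v hv =>
      obtain ⟨j, rfl⟩ := hv
      exact pow_eq_zero_iff two_ne_zero |>.1 (h0 j (Finset.mem_univ j))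
    | zero => simp
    | add u v _ _ hu hv => rw [add_dotProduct, hu, hv, add_zero]
    | smul c v _ hv => rw [smul_dotProduct, hv, smul_zero]
  exact dotProduct_self_eq_zero.1 (hspan w (by rw [hx₀]; trivial))

variable {n m : ℕ} (A : Matrix (Fin n) (Fin n) ℝ) (B : Matrix (Fin n) (Fin m) ℝ)
  (Q : Matrix (Fin n) (Fin n) ℝ) (R : Matrix (Fin m) (Fin m) ℝ) (x₀ : Fin n → Fin n → ℝ)

/-- The Gramian `X(K) = ∑ⱼ ∫₀^∞ xⱼ(t) xⱼ(t)ᵀ dt` of the closed loop, as the solution of its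
Lyapunov equation. -/
noncomputable def closedLoopGramian (K : Matrix (Fin m) (Fin n) ℝ) : Matrix (Fin n) (Fin n) ℝ :=
  lyapunovSol (A - B * K) (initialMoment x₀)

/-- The matrix `P(K)` of the quadratic form `ξ ↦ J_ξ(K)`, as the solution of its Lyapunov
equation. -/
noncomputable def costToGo (K : Matrix (Fin m) (Fin n) ℝ) : Matrix (Fin n) (Fin n) ℝ :=
  lyapunovSol (A - B * K)ᵀ (Q + Kᵀ * R * K)

/-- The matrix `E(K) = R K - Bᵀ P(K)`; the gradient of the cost is `2 E(K) X(K)`. -/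
noncomputable def gainResidual (K : Matrix (Fin m) (Fin n) ℝ) : Matrix (Fin m) (Fin n) ℝ :=
  R * K - Bᵀ * costToGo A B Q R K

variable {A B Q R x₀} {K : Matrix (Fin m) (Fin n) ℝ}

theorem stageCost_posSemidef (hQ : Q.PosSemidef) (hR : R.PosDef) (K : Matrix (Fin m) (Fin n) ℝ) :
    (Q + Kᵀ * R * K).PosSemidef :=
  hQ.add (by simpa using hR.posSemidef.conjTranspose_mul_mul_same K)

theorem closedLoopGramian_spec (hK : K ∈ stabilizingGains A B) :
    (A - B * K) * closedLoopGramian A B x₀ K + closedLoopGramian A B x₀ K * (A - B * K)ᵀ =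
      -initialMoment x₀ :=
  IsHurwitz.lyapunovSol_spec hK _

theorem costToGo_spec (hK : K ∈ stabilizingGains A B) :
    (A - B * K)ᵀ * costToGo A B Q R K + costToGo A B Q R K * (A - B * K) =
      -(Q + Kᵀ * R * K) := by
  have h := (IsHurwitz.transpose hK).lyapunovSol_spec (Q + Kᵀ * R * K)
  rwa [Matrix.transpose_transpose] at h

theorem closedLoopGramian_posDef (hx₀ : Submodule.span ℝ (Set.range x₀) = ⊤)
    (hK : K ∈ stabilizingGains A B) : (closedLoopGramian A B x₀ K).PosDef :=
  IsHurwitz.posDef_of_lyapunov hK (initialMoment_posDef hx₀) (closedLoopGramian_spec hK)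

theorem closedLoopGramian_transpose (hK : K ∈ stabilizingGains A B) :
    (closedLoopGramian A B x₀ K)ᵀ = closedLoopGramian A B x₀ K :=
  (IsHurwitz.posSemidef_of_lyapunov hK (initialMoment_posSemidef x₀)
    (closedLoopGramian_spec hK)).isHermitian.eq

theorem costToGo_transpose (hQ : Q.PosSemidef) (hR : R.PosDef) (hK : K ∈ stabilizingGains A B) :
    (costToGo A B Q R K)ᵀ = costToGo A B Q R K :=
  ((IsHurwitz.transpose hK).posSemidef_of_lyapunov (stageCost_posSemidef hQ hR K)
    (IsHurwitz.lyapunovSol_spec (IsHurwitz.transpose hK) _)).isHermitian.eq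

/-- The integrand is minus the derivative of x(t)ᵀ P x(t), which tends to 0, so the integral is its
value at t = 0. Nonnegativity of the integrand also gives integrability. -/
theorem lqrCostFrom_eq (hQ : Q.PosSemidef) (hR : R.PosDef) (hK : K ∈ stabilizingGains A B)
    (ξ : Fin n → ℝ) : lqrCostFrom A B Q R ξ K = ξ ⬝ᵥ (costToGo A B Q R K *ᵥ ξ) := by
  set P := costToGo A B Q R K with hP
  have hKt : IsHurwitz (A - B * K)ᵀ := IsHurwitz.transpose hK
  have hexp : ∀ t : ℝ, (NormedSpace.exp (t • (A - B * K)ᵀ))ᵀ *ᵥ ξ =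
      closedLoopState A B K ξ t := fun t => by
    rw [← Matrix.transpose_smul, Matrix.exp_transpose, Matrix.transpose_transpose, closedLoopState]
  have hd : ∀ t : ℝ, HasDerivAt (fun t => closedLoopState A B K ξ t ⬝ᵥ
      (P *ᵥ closedLoopState A B K ξ t)) (-(closedLoopState A B K ξ t ⬝ᵥ
      ((Q + Kᵀ * R * K) *ᵥ closedLoopState A B K ξ t))) t := by
    intro t
    have h := hasDerivAt_dotProduct_exp (A - B * K)ᵀ P ξ t
    simp_rw [hexp] at h
    rwa [Matrix.transpose_transpose, hP, costToGo_spec hK, Matrix.neg_mulVec, dotProduct_neg] at h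
  have hlim := hKt.tendsto_dotProduct_exp P ξ
  simp_rw [hexp] at hlim
  have hint : ∀ t, closedLoopState A B K ξ t ⬝ᵥ (Q *ᵥ closedLoopState A B K ξ t) +
      closedLoopInput A B K ξ t ⬝ᵥ (R *ᵥ closedLoopInput A B K ξ t) =
      closedLoopState A B K ξ t ⬝ᵥ ((Q + Kᵀ * R * K) *ᵥ closedLoopState A B K ξ t) := by
    intro t
    rw [closedLoopInput, Matrix.mulVec_neg, neg_dotProduct_neg, Matrix.add_mulVec,
      dotProduct_add, ← Matrix.mulVec_mulVec, ← Matrix.mulVec_mulVec,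
      Matrix.dotProduct_mulVec _ Kᵀ, ← Matrix.mulVec_transpose, Matrix.transpose_transpose]
  have hI := MeasureTheory.integral_Ioi_of_hasDerivAt_of_nonpos' (a := 0) (fun t _ => hd t)
    (fun t _ => neg_nonpos.2 ((stageCost_posSemidef hQ hR K).dotProduct_mulVec_nonneg _)) hlim
  rw [MeasureTheory.integral_neg] at hI
  rw [lqrCostFrom]
  simp_rw [hint]
  have h0 : closedLoopState A B K ξ 0 = ξ := by simp [closedLoopState]
  rw [h0] at hI
  linarith

theorem lqrCost_eq_trace (hQ : Q.PosSemidef) (hR : R.PosDef) (hK : K ∈ stabilizingGains A B) :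
    lqrCost A B Q R x₀ K = (costToGo A B Q R K * initialMoment x₀).trace := by
  rw [lqrCost, initialMoment, Matrix.mul_sum, Matrix.trace_sum]
  refine Finset.sum_congr rfl fun j _ => ?_
  rw [lqrCostFrom_eq hQ hR hK, Matrix.mul_vecMulVec, Matrix.trace_vecMulVec, dotProduct_comm]

/-- The cost as a trace against the Gramian of another closed loop. -/
theorem lqrCost_eq_neg_trace (hQ : Q.PosSemidef) (hR : R.PosDef) (hK : K ∈ stabilizingGains A B)
    {L : Matrix (Fin m) (Fin n) ℝ} (hL : L ∈ stabilizingGains A B) :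
    lqrCost A B Q R x₀ K = -(((A - B * L)ᵀ * costToGo A B Q R K +
      costToGo A B Q R K * (A - B * L)) * closedLoopGramian A B x₀ L).trace := by
  rw [lqrCost_eq_trace hQ hR hK, ← neg_neg (initialMoment x₀), ← closedLoopGramian_spec hL,
    Matrix.mul_neg, Matrix.trace_neg, Matrix.mul_add, Matrix.add_mul, Matrix.trace_add,
    Matrix.trace_add, add_comm]
  congr 2
  · rw [← Matrix.mul_assoc, Matrix.trace_mul_comm, Matrix.mul_assoc]
  · rw [Matrix.mul_assoc]

theorem lqrCost_eq_trace_gramian (hQ : Q.PosSemidef) (hR : R.PosDef)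
    (hK : K ∈ stabilizingGains A B) :
    lqrCost A B Q R x₀ K = ((Q + Kᵀ * R * K) * closedLoopGramian A B x₀ K).trace := by
  rw [lqrCost_eq_neg_trace hQ hR hK hK, costToGo_spec hK, Matrix.neg_mul, Matrix.trace_neg,
    neg_neg]

/-- The exact expansion of the cost around a stabilizing gain. -/
theorem lqrCost_sub (hQ : Q.PosSemidef) (hR : R.PosDef) (hK : K ∈ stabilizingGains A B)
    {L : Matrix (Fin m) (Fin n) ℝ} (hL : L ∈ stabilizingGains A B) :
    lqrCost A B Q R x₀ L - lqrCost A B Q R x₀ K =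
      2 * ⟪gainResidual A B Q R K * closedLoopGramian A B x₀ L, L - K⟫ +
        ⟪R * (L - K) * closedLoopGramian A B x₀ L, L - K⟫ := by
  have hRt : Rᵀ = R := hR.isHermitian.eq
  have hPt := costToGo_transpose hQ hR hK
  have hP := costToGo_spec (Q := Q) (R := R) hK
  rw [lqrCost_eq_trace_gramian hQ hR hL, lqrCost_eq_neg_trace hQ hR hK hL, sub_neg_eq_add,
    ← Matrix.trace_add, ← Matrix.add_mul]
  set P := costToGo A B Q R K with hPdef
  set X := closedLoopGramian A B x₀ L
  set D := L - K with hD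
  have hE : gainResidual A B Q R K = R * K - Bᵀ * P := rfl
  set E := gainResidual A B Q R K
  have hLK : L = K + D := by rw [hD]; abel
  -- Expanding about `K`, the Lyapunov equation of `P` cancels the terms of order zero in `D`; the
  -- first-order terms collect into `E`.
  have hmat : Q + Lᵀ * R * L + ((A - B * L)ᵀ * P + P * (A - B * L)) =
      Eᵀ * D + Dᵀ * E + Dᵀ * (R * D) := by
    have hsplit : (A - B * L)ᵀ * P + P * (A - B * L) =
        ((A - B * K)ᵀ * P + P * (A - B * K)) - Dᵀ * (Bᵀ * P) - P * B * D := by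
      rw [hLK]
      simp only [Matrix.transpose_sub, Matrix.transpose_mul, Matrix.mul_add, Matrix.mul_sub,
        Matrix.sub_mul, Matrix.add_mul, Matrix.transpose_add, Matrix.mul_assoc]
      abel
    rw [hsplit, hP, hE, hLK]
    simp only [Matrix.transpose_sub, Matrix.transpose_mul, Matrix.mul_add, Matrix.mul_sub,
      Matrix.sub_mul, Matrix.add_mul, Matrix.transpose_add, Matrix.mul_assoc,
      Matrix.transpose_transpose, hRt, hPt]
    abel
  have h1 : (Eᵀ * D * X).trace = ⟪E * X, D⟫ := by
    rw [frobenius_inner_def, Matrix.transpose_mul]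
    rw [closedLoopGramian_transpose hL, Matrix.mul_assoc X, Matrix.trace_mul_comm X]
  have h2 : (Dᵀ * E * X).trace = ⟪E * X, D⟫ := by
    rw [real_inner_comm, frobenius_inner_def, Matrix.mul_assoc]
  have h3 : (Dᵀ * (R * D) * X).trace = ⟪R * D * X, D⟫ := by
    rw [real_inner_comm, frobenius_inner_def, Matrix.mul_assoc]
  rw [hmat, Matrix.add_mul, Matrix.add_mul, Matrix.trace_add, Matrix.trace_add, h1, h2, h3]
  ring

/-- One Lyapunov certificate serves all nearby gains: for `X` solving the equation of `K` with right
side `-1`, a perturbation of norm below 1 leaves the left side negative definite. -/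
theorem isOpen_stabilizingGains (A : Matrix (Fin n) (Fin n) ℝ) (B : Matrix (Fin n) (Fin m) ℝ) :
    IsOpen (stabilizingGains A B) := by
  rw [isOpen_iff_mem_nhds]
  intro K hK
  set X := lyapunovSol (A - B * K) 1 with hX
  have hspec : (A - B * K) * X + X * (A - B * K)ᵀ = -1 := IsHurwitz.lyapunovSol_spec hK 1
  have hXpos : X.PosSemidef := IsHurwitz.posSemidef_of_lyapunov hK Matrix.PosSemidef.one hspec
  have hcont : ContinuousAt (fun L => (A - B * L) * X + X * (A - B * L)ᵀ + 1) K := by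
    fun_prop
  have hnear : ∀ᶠ L in 𝓝 K, ‖(A - B * L) * X + X * (A - B * L)ᵀ + 1‖ < 1 := by
    refine hcont.norm.eventually_lt continuousAt_const ?_
    simpa only [hspec, neg_add_cancel, norm_zero] using one_pos
  filter_upwards [hnear] with L hL
  refine isHurwitz_of_lyapunov hXpos fun w hw => ?_
  set D := (A - B * L) * X + X * (A - B * L)ᵀ + 1 with hD
  have hpos : 0 < w ⬝ᵥ w := by simpa using Matrix.dotProduct_star_self_pos_iff.2 hw
  have h1 := (abs_le.1 (abs_dotProduct_mulVec_le D w)).2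
  have h2 : (A - B * L) * X + X * (A - B * L)ᵀ = D - 1 := by rw [hD]; abel
  rw [h2, Matrix.sub_mulVec, dotProduct_sub, Matrix.one_mulVec]
  nlinarith

theorem contDiffAt_matrix_mul {k l p : ℕ} {E : Type*} [NormedAddCommGroup E] [NormedSpace ℝ E]
    {F : E → Matrix (Fin k) (Fin l) ℝ} {G : E → Matrix (Fin l) (Fin p) ℝ} {x : E}
    {r : WithTop ℕ∞} (hF : ContDiffAt ℝ r F x) (hG : ContDiffAt ℝ r G x) :
    ContDiffAt ℝ r (fun y => F y * G y) x := by
  have hb : IsBoundedBilinearMap ℝ fun q : Matrix (Fin k) (Fin l) ℝ × Matrix (Fin l) (Fin p) ℝ =>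
      q.1 * q.2 :=
    { add_left := Matrix.add_mul
      smul_left := Matrix.smul_mul
      add_right := Matrix.mul_add
      smul_right := fun c M N => Matrix.mul_smul M c N
      bound := ⟨1, one_pos, fun M N => by
        rw [one_mul]; exact Matrix.frobenius_norm_mul M N⟩ }
  exact hb.contDiff.contDiffAt.comp x (hF.prodMk hG)

theorem contDiffAt_matrix_transpose {k l : ℕ} {E : Type*} [NormedAddCommGroup E]
    [NormedSpace ℝ E] {F : E → Matrix (Fin k) (Fin l) ℝ} {x : E} {r : WithTop ℕ∞}
    (hF : ContDiffAt ℝ r F x) : ContDiffAt ℝ r (fun y => (F y)ᵀ) x := by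
  have h : IsBoundedLinearMap ℝ fun M : Matrix (Fin k) (Fin l) ℝ => Mᵀ :=
    { map_add := Matrix.transpose_add
      map_smul := Matrix.transpose_smul
      bound := ⟨1, one_pos, fun M => by rw [one_mul, Matrix.frobenius_norm_transpose]⟩ }
  exact h.contDiff.contDiffAt.comp x hF

theorem contDiffAt_closedLoopGramian (hK : K ∈ stabilizingGains A B) {r : WithTop ℕ∞} :
    ContDiffAt ℝ r (closedLoopGramian A B x₀) K :=
  contDiffAt_lyapunovSol (contDiffAt_const.sub (contDiffAt_matrix_mul contDiffAt_const
    contDiffAt_id)) contDiffAt_const hK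

theorem contDiffAt_gainResidual (hK : K ∈ stabilizingGains A B) {r : WithTop ℕ∞} :
    ContDiffAt ℝ r (gainResidual A B Q R) K := by
  have hP : ContDiffAt ℝ r (costToGo A B Q R) K :=
    contDiffAt_lyapunovSol (contDiffAt_matrix_transpose (contDiffAt_const.sub
      (contDiffAt_matrix_mul contDiffAt_const contDiffAt_id))) (contDiffAt_const.add
      (contDiffAt_matrix_mul (contDiffAt_matrix_mul (contDiffAt_matrix_transpose contDiffAt_id)
        contDiffAt_const) contDiffAt_id)) (IsHurwitz.transpose hK)
  exact (contDiffAt_matrix_mul contDiffAt_const contDiffAt_id).sub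
    (contDiffAt_matrix_mul contDiffAt_const hP)

/-- The error ⟪g y - g x, y - x⟫ is o(‖y - x‖) as soon as `g` is continuous. Hence the exact
expansion of the cost yields its gradient without differentiating the Gramian. -/
theorem hasGradientAt_add_inner_sub {E : Type*} [NormedAddCommGroup E] [InnerProductSpace ℝ E]
    [CompleteSpace E] {g : E → E} {x : E} (hg : ContinuousAt g x) (c : ℝ) :
    HasGradientAt (fun y => c + ⟪g y, y - x⟫) (g x) x := by
  rw [hasGradientAt_iff_isLittleO, Asymptotics.isLittleO_iff]
  intro ε hε
  filter_upwards [Metric.tendsto_nhds.1 hg ε hε] with y hy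
  rw [sub_self, inner_zero_right, add_zero, add_sub_cancel_left, ← inner_sub_left]
  refine (norm_inner_le_norm _ _).trans ?_
  rw [dist_eq_norm] at hy
  gcongr

theorem hasGradientAt_lqrCost (hQ : Q.PosSemidef) (hR : R.PosDef)
    (hK : K ∈ stabilizingGains A B) :
    HasGradientAt (lqrCost A B Q R x₀)
      ((2 : ℝ) • (gainResidual A B Q R K * closedLoopGramian A B x₀ K)) K := by
  have hX : ContinuousAt (closedLoopGramian A B x₀) K :=
    (contDiffAt_closedLoopGramian (r := 0) hK).continuousAt
  have hg : ContinuousAt (fun L => (2 : ℝ) • (gainResidual A B Q R K * closedLoopGramian A B x₀ L)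
      + R * (L - K) * closedLoopGramian A B x₀ L) K := by
    fun_prop
  have h := hasGradientAt_add_inner_sub hg (lqrCost A B Q R x₀ K)
  rw [sub_self, Matrix.mul_zero, Matrix.zero_mul, add_zero] at h
  refine h.congr_of_eventuallyEq ?_
  filter_upwards [(isOpen_stabilizingGains A B).mem_nhds hK] with L hL
  rw [inner_add_left, real_inner_smul_left, ← lqrCost_sub hQ hR hK hL]
  ring

theorem gradient_lqrCost (hQ : Q.PosSemidef) (hR : R.PosDef) (hK : K ∈ stabilizingGains A B) :
    gradient (lqrCost A B Q R x₀) K =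
      (2 : ℝ) • (gainResidual A B Q R K * closedLoopGramian A B x₀ K) :=
  (hasGradientAt_lqrCost hQ hR hK).gradient

theorem differentiableAt_lqrCost (hQ : Q.PosSemidef) (hR : R.PosDef)
    (hK : K ∈ stabilizingGains A B) : DifferentiableAt ℝ (lqrCost A B Q R x₀) K :=
  (hasGradientAt_lqrCost hQ hR hK).differentiableAt

theorem contDiffOn_gradient_lqrCost (hQ : Q.PosSemidef) (hR : R.PosDef) {r : WithTop ℕ∞} :
    ContDiffOn ℝ r (gradient (lqrCost A B Q R x₀)) (stabilizingGains A B) := by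
  have h : ContDiffOn ℝ r (fun K => (2 : ℝ) • (gainResidual A B Q R K *
      closedLoopGramian A B x₀ K)) (stabilizingGains A B) := fun K hK =>
    ((contDiffAt_matrix_mul (contDiffAt_gainResidual hK)
      (contDiffAt_closedLoopGramian hK)).const_smul (2 : ℝ)).contDiffWithinAt
  exact h.congr fun K hK => gradient_lqrCost hQ hR hK

end LQR

/-! ### Compactness of the sublevel sets -/

section SublevelSets

open Filter Topology
open scoped RealInnerProductSpace

theorem trace_mul_eq_norm_sq {n : ℕ} (C D : Matrix (Fin n) (Fin n) ℝ) :
    ((Cᵀ * C) * (Dᵀ * D)).trace = ‖C * Dᵀ‖ ^ 2 := by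
  rw [← real_inner_self_eq_norm_sq, frobenius_inner_def, Matrix.transpose_mul,
    Matrix.transpose_transpose, ← Matrix.mul_assoc (Cᵀ * C), Matrix.trace_mul_comm]
  simp only [Matrix.mul_assoc]

theorem Matrix.PosSemidef.trace_mul_nonneg_of_real {n : ℕ} {X Y : Matrix (Fin n) (Fin n) ℝ}
    (hX : X.PosSemidef) (hY : Y.PosSemidef) : 0 ≤ (X * Y).trace := by
  obtain ⟨C, rfl⟩ := exists_eq_transpose_mul_self hX
  obtain ⟨D, rfl⟩ := exists_eq_transpose_mul_self hY
  rw [trace_mul_eq_norm_sq]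
  positivity

/-- For X = CᵀC and Y = DᵀD the trace is ‖CDᵀ‖², so it can only be nonpositive if CDᵀ = 0. -/
theorem Matrix.PosSemidef.mul_eq_zero_of_trace_nonpos {n : ℕ} {X Y : Matrix (Fin n) (Fin n) ℝ}
    (hX : X.PosSemidef) (hY : Y.PosSemidef) (h : (X * Y).trace ≤ 0) : X * Y = 0 := by
  obtain ⟨C, rfl⟩ := exists_eq_transpose_mul_self hX
  obtain ⟨D, rfl⟩ := exists_eq_transpose_mul_self hY
  rw [trace_mul_eq_norm_sq] at h
  have h0 : C * Dᵀ = 0 := norm_eq_zero.1 (pow_eq_zero_iff two_ne_zero |>.1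
    (le_antisymm h (sq_nonneg _)))
  rw [Matrix.mul_assoc, ← Matrix.mul_assoc C, h0, Matrix.zero_mul, Matrix.mul_zero]

theorem isClosed_setOf_posSemidef (n : ℕ) :
    IsClosed {X : Matrix (Fin n) (Fin n) ℝ | X.PosSemidef} := by
  have : {X : Matrix (Fin n) (Fin n) ℝ | X.PosSemidef} =
      {X | Xᵀ = X} ∩ ⋂ w : Fin n → ℝ, {X | 0 ≤ w ⬝ᵥ (X *ᵥ w)} := by
    ext X
    simp only [mem_ofPred_eq, mem_inter_iff, mem_iInter]
    exact Matrix.posSemidef_iff_dotProduct_mulVec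
  rw [this]
  refine IsClosed.inter (isClosed_eq (by fun_prop) (by fun_prop)) (isClosed_iInter fun w => ?_)
  exact isClosed_le (by fun_prop) (by fun_prop)

/-- Observability of the imaginary-axis eigenvalues excludes nonzero positive semidefinite
solutions of `A Y + Y Aᵀ = 0` annihilated by `Q`. -/
theorem ImaginaryAxisObservable.eq_zero {n : ℕ} {A Q Y : Matrix (Fin n) (Fin n) ℝ}
    (hobs : ImaginaryAxisObservable Q A) (hY : Y.PosSemidef) (h : A * Y + Y * Aᵀ = 0)
    (hQY : Q * Y = 0) : Y = 0 := by
  by_contra hY0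
  have hYt : Yᵀ = Y := hY.isHermitian.eq
  have hmapmul : ∀ M N : Matrix (Fin n) (Fin n) ℝ, (M * N).map (algebraMap ℝ ℂ) =
      M.map (algebraMap ℝ ℂ) * N.map (algebraMap ℝ ℂ) := fun M N => Matrix.map_mul
  set Yc := Y.map (algebraMap ℝ ℂ) with hYc
  set Ac := A.map (algebraMap ℝ ℂ) with hAc
  have hAY : Ac * Yc = Yc * (-Aᵀ).map (algebraMap ℝ ℂ) := by
    rw [← hmapmul, ← hmapmul, Matrix.mul_neg, ← eq_neg_of_add_eq_zero_left h]
  set V := LinearMap.range (Matrix.toLin' Yc) with hV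
  -- Since AY = -YAᵀ, the range of Y is A-invariant, so A has an eigenvector of the form v = Yw.
  have hinv : ∀ v ∈ V, Matrix.toLin' Ac v ∈ V := by
    rintro _ ⟨w, rfl⟩
    refine ⟨(-Aᵀ).map (algebraMap ℝ ℂ) *ᵥ w, ?_⟩
    rw [Matrix.toLin'_apply, Matrix.toLin'_apply, Matrix.toLin'_apply, Matrix.mulVec_mulVec,
      Matrix.mulVec_mulVec, hAY]
  have hVne : Nontrivial V := by
    rw [Submodule.nontrivial_iff_ne_bot, hV, Ne, LinearMap.range_eq_bot]
    intro h0
    have hYc0 : Yc = 0 := by simpa using h0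
    refine hY0 (Matrix.ext fun i j => ?_)
    have := congrFun (congrFun hYc0 i) j
    simpa [hYc] using this
  obtain ⟨μ, hμ⟩ := Module.End.exists_eigenvalue ((Matrix.toLin' Ac).restrict hinv)
  obtain ⟨⟨v, hvV⟩, hv⟩ := hμ.exists_hasEigenvector
  have hv0 : v ≠ 0 := fun h0 => hv.2 (Subtype.ext h0)
  have hAv : Ac *ᵥ v = μ • v := congrArg Subtype.val hv.apply_eq_smul
  obtain ⟨w, hw⟩ := hvV
  rw [Matrix.toLin'_apply] at hw
  obtain ⟨ha, hb⟩ := re_im_of_map_mulVec_eq_smul (M := Y) (μ := 1) (w := v)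
    (by rw [one_smul]; exact hw)
  obtain ⟨hva, hvb⟩ := re_im_of_map_mulVec_eq_smul hAv
  set a : Fin n → ℝ := fun i => (w i).re
  set b : Fin n → ℝ := fun i => (w i).im
  simp only [Complex.one_re, Complex.one_im, one_smul, zero_smul, sub_zero, zero_add] at ha hb
  rw [← ha, ← hb] at hva hvb
  have hskew : ∀ u : Fin n → ℝ, u ⬝ᵥ (A *ᵥ (Y *ᵥ u)) = 0 := by
    intro u
    have h1 := dotProduct_lyapunov (M := A) hYt u
    rw [h, Matrix.zero_mulVec, dotProduct_zero] at h1
    rw [Matrix.dotProduct_mulVec, ← Matrix.mulVec_transpose]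
    linarith
  have h1 := hskew a
  have h2 := hskew b
  rw [hva, dotProduct_sub, dotProduct_smul, dotProduct_smul] at h1
  rw [hvb, dotProduct_add, dotProduct_smul, dotProduct_smul] at h2
  rw [dotProduct_mulVec_comm_of_transpose_eq hYt b a] at h2
  simp only [smul_eq_mul] at h1 h2
  have hpa : 0 ≤ a ⬝ᵥ (Y *ᵥ a) := by simpa using hY.dotProduct_mulVec_nonneg a
  have hpb : 0 ≤ b ⬝ᵥ (Y *ᵥ b) := by simpa using hY.dotProduct_mulVec_nonneg b
  -- Adding `h1` and `h2` gives Re μ · (w*Yw) = 0, and w*Yw = 0 would force v = Yw = 0.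
  have hre : μ.re = 0 := by
    have hsum : μ.re * (a ⬝ᵥ (Y *ᵥ a) + b ⬝ᵥ (Y *ᵥ b)) = 0 := by linarith
    refine (mul_eq_zero.1 hsum).resolve_right fun h0 => hv0 ?_
    have hYa := (hY.dotProduct_mulVec_zero_iff a).1 (by simpa using (by linarith))
    have hYb := (hY.dotProduct_mulVec_zero_iff b).1 (by simpa using (by linarith))
    exact funext fun i => Complex.ext ((congrFun ha i).symm.trans (congrFun hYa i))
      ((congrFun hb i).symm.trans (congrFun hYb i))
  refine hobs μ v hre hv0 hAv ?_
  rw [← hw, Matrix.mulVec_mulVec, ← hmapmul, hQY]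
  simp

/-- A lower bound for the solution of a Lyapunov equation. -/
theorem le_dotProduct_of_lyapunov {n : ℕ} {M X S : Matrix (Fin n) (Fin n) ℝ} (hX : X.PosDef)
    (h : M * X + X * Mᵀ = -S) {s : ℝ} (hs : 0 < s) (hS : ∀ w, s * (w ⬝ᵥ w) ≤ w ⬝ᵥ (S *ᵥ w))
    (w : Fin n → ℝ) : s / (2 * (‖M‖ + 1)) * (w ⬝ᵥ w) ≤ w ⬝ᵥ (X *ᵥ w) := by
  have hXt : Xᵀ = X := hX.isHermitian.eq
  set a := s / (2 * (‖M‖ + 1)) with ha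
  have hM : 0 ≤ ‖M‖ := norm_nonneg M
  have has : a * (2 * (‖M‖ + 1)) = s := div_mul_cancel₀ s (by positivity)
  have ha0 : 0 < a := by positivity
  have hY : (X - a • (1 : Matrix (Fin n) (Fin n) ℝ)).IsHermitian := by
    rw [Matrix.IsHermitian, Matrix.conjTranspose_eq_transpose_of_trivial, Matrix.transpose_sub, hXt,
      Matrix.transpose_smul, Matrix.transpose_one]
  have hpsd : (X - a • (1 : Matrix (Fin n) (Fin n) ℝ)).PosSemidef := by
    rw [hY.posSemidef_iff_eigenvalues_nonneg]
    intro i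
    by_contra hneg
    simp only [Pi.zero_apply, not_le] at hneg
    set l := hY.eigenvalues i with hl
    set v : Fin n → ℝ := (hY.eigenvectorBasis i).ofLp with hv
    have hv0 : v ≠ 0 := fun h0 =>
      hY.eigenvectorBasis.orthonormal.ne_zero i (by ext j; exact congrFun h0 j)
    have hvv : 0 < v ⬝ᵥ v := by simpa using Matrix.dotProduct_star_self_pos_iff.2 hv0
    have hXv : X *ᵥ v = (l + a) • v := by
      have := hY.mulVec_eigenvectorBasis i
      rw [Matrix.sub_mulVec, Matrix.smul_mulVec, Matrix.one_mulVec, sub_eq_iff_eq_add] at this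
      rw [add_smul]
      exact this
    have hla : 0 < l + a := by
      have := hX.dotProduct_mulVec_pos hv0
      rw [star_trivial, hXv, dotProduct_smul, smul_eq_mul] at this
      exact pos_of_mul_pos_left this hvv.le
    -- On an eigenvector of `X` with eigenvalue l + a < a, the equation gives vᵀSv ≤ 2a‖M‖ vᵀv < s
    -- vᵀv, contradicting the lower bound on `S`.
    have h1 := dotProduct_lyapunov (M := M) hXt v
    rw [h, hXv, dotProduct_smul, Matrix.neg_mulVec, dotProduct_neg, smul_eq_mul,
      Matrix.mulVec_transpose, ← Matrix.dotProduct_mulVec] at h1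
    have h2 := (abs_le.1 (abs_dotProduct_mulVec_le M v)).1
    have h3 := hS v
    have h4 : s * (v ⬝ᵥ v) ≤ 2 * ((l + a) * (‖M‖ * (v ⬝ᵥ v))) := by
      nlinarith [mul_le_mul_of_nonneg_left h2 hla.le]
    have h5 : (l + a) * (‖M‖ * (v ⬝ᵥ v)) ≤ a * (‖M‖ * (v ⬝ᵥ v)) :=
      mul_le_mul_of_nonneg_right (by linarith) (mul_nonneg hM hvv.le)
    have h6 : 0 < a * (v ⬝ᵥ v) := mul_pos ha0 hvv
    rw [← has] at h4
    nlinarith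
  have := hpsd.dotProduct_mulVec_nonneg w
  rw [star_trivial, Matrix.sub_mulVec, Matrix.smul_mulVec, Matrix.one_mulVec, dotProduct_sub,
    dotProduct_smul, smul_eq_mul] at this
  linarith

variable {n m : ℕ} {A : Matrix (Fin n) (Fin n) ℝ} {B : Matrix (Fin n) (Fin m) ℝ}
  {Q : Matrix (Fin n) (Fin n) ℝ} {R : Matrix (Fin m) (Fin m) ℝ} {x₀ : Fin n → Fin n → ℝ}

/-- Sublevel sets of the cost are bounded. -/
theorem exists_norm_le_of_lqrCost_le (hQ : Q.PosSemidef) (hR : R.PosDef)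
    (hx₀ : Submodule.span ℝ (Set.range x₀) = ⊤) (c : ℝ) :
    ∃ b, ∀ K ∈ stabilizingGains A B, lqrCost A B Q R x₀ K ≤ c → ‖K‖ ≤ b := by
  obtain ⟨s, hs, hS⟩ := (initialMoment_posDef hx₀).exists_pos_le
  obtain ⟨r, hr, hRr⟩ := hR.exists_pos_le
  have hRt : Rᵀ = R := hR.isHermitian.eq
  -- The cost dominates a multiple of ‖K‖² / (‖A - BK‖ + 1), whose denominator grows at most
  -- linearly in ‖K‖. The summand 1 ensures ‖K‖ ≥ 1 in the argument by contradiction.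
  refine ⟨1 + 2 * |c| * (‖A‖ + ‖B‖ + 1) / (r * s), fun K hK hc => ?_⟩
  have hX := closedLoopGramian_posDef hx₀ hK
  have hlow := le_dotProduct_of_lyapunov hX (closedLoopGramian_spec hK) hs hS
  set X := closedLoopGramian A B x₀ K
  have h1 := le_frobenius_inner_mul_mul hX.posSemidef hr.le hRt hRr hlow K
  have h2 : ⟪R * K * X, K⟫ ≤ c := by
    refine le_trans ?_ hc
    rw [lqrCost_eq_trace_gramian hQ hR hK, Matrix.add_mul, Matrix.trace_add, real_inner_comm,
      frobenius_inner_def, Matrix.mul_assoc Kᵀ R K, Matrix.mul_assoc Kᵀ]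
    exact le_add_of_nonneg_left (hQ.trace_mul_nonneg_of_real hX.posSemidef)
  have hM : ‖A - B * K‖ ≤ ‖A‖ + ‖B‖ * ‖K‖ :=
    (norm_sub_le _ _).trans (by gcongr; exact Matrix.frobenius_norm_mul B K)
  by_contra hlt
  push Not at hlt
  have hk1 : 1 ≤ ‖K‖ := by
    refine le_trans ?_ hlt.le
    have : 0 ≤ 2 * |c| * (‖A‖ + ‖B‖ + 1) / (r * s) := by positivity
    linarith
  have h3 : r * (s / (2 * (‖A - B * K‖ + 1))) * ‖K‖ ^ 2 ≤ |c| :=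
    (h1.trans h2).trans (le_abs_self c)
  have h4 : r * s * ‖K‖ ^ 2 ≤ |c| * (2 * (‖A - B * K‖ + 1)) := by
    rw [mul_div_assoc', div_mul_eq_mul_div, div_le_iff₀ (by positivity)] at h3
    exact h3
  have h5 : ‖A - B * K‖ + 1 ≤ (‖A‖ + ‖B‖ + 1) * ‖K‖ := by nlinarith [norm_nonneg A]
  have h6 : r * s * ‖K‖ * ‖K‖ ≤ 2 * |c| * (‖A‖ + ‖B‖ + 1) * ‖K‖ := by
    nlinarith [mul_le_mul_of_nonneg_left h5 (abs_nonneg c)]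
  have h7 := le_of_mul_le_mul_right h6 (by linarith)
  have h8 : ‖K‖ ≤ 2 * |c| * (‖A‖ + ‖B‖ + 1) / (r * s) := by
    rw [le_div_iff₀ (by positivity)]
    linarith
  linarith

/-- Sublevel sets of the cost are compact. -/
theorem isCompact_sublevel_lqrCost (hQ : Q.PosSemidef) (hR : R.PosDef)
    (hobs : ImaginaryAxisObservable Q A) (hx₀ : Submodule.span ℝ (Set.range x₀) = ⊤) (c : ℝ) :
    IsCompact {K | K ∈ stabilizingGains A B ∧ lqrCost A B Q R x₀ K ≤ c} := by
  obtain ⟨b, hb⟩ := exists_norm_le_of_lqrCost_le (A := A) (B := B) hQ hR hx₀ c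
  -- Triples (K, εX(K), ε), scaled so that ‖εX‖ + ε = 1, satisfy closed conditions that no longer
  -- mention stability. The value ε = 0 encodes a Gramian escaping to infinity; once it is excluded,
  -- the sublevel set is the projection of the compact `T`.
  set T : Set (Matrix (Fin m) (Fin n) ℝ × Matrix (Fin n) (Fin n) ℝ × ℝ) :=
    {p | ‖p.1‖ ≤ b ∧ p.2.1.PosSemidef ∧ 0 ≤ p.2.2 ∧ ‖p.2.1‖ + p.2.2 = 1 ∧
      (A - B * p.1) * p.2.1 + p.2.1 * (A - B * p.1)ᵀ = -(p.2.2 • initialMoment x₀) ∧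
      ((Q + p.1ᵀ * R * p.1) * p.2.1).trace ≤ p.2.2 * c} with hT
  have hTclosed : IsClosed T := by
    have hA : Continuous fun p : Matrix (Fin m) (Fin n) ℝ × Matrix (Fin n) (Fin n) ℝ × ℝ =>
        (A - B * p.1) * p.2.1 + p.2.1 * (A - B * p.1)ᵀ := by fun_prop
    have hc : Continuous fun p : Matrix (Fin m) (Fin n) ℝ × Matrix (Fin n) (Fin n) ℝ × ℝ =>
        ((Q + p.1ᵀ * R * p.1) * p.2.1).trace := by fun_prop
    exact (isClosed_le continuous_fst.norm continuous_const).inter <|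
      ((isClosed_setOf_posSemidef n).preimage (continuous_fst.comp continuous_snd)).inter <|
      (isClosed_le continuous_const (continuous_snd.comp continuous_snd)).inter <|
      (isClosed_eq ((continuous_fst.comp continuous_snd).norm.add
        (continuous_snd.comp continuous_snd)) continuous_const).inter <|
      (isClosed_eq hA ((continuous_snd.comp continuous_snd).smul continuous_const).neg).inter <|
      isClosed_le hc ((continuous_snd.comp continuous_snd).mul continuous_const)
  have hTcompact : IsCompact T := by
    have := FiniteDimensional.proper ℝ
      (Matrix (Fin m) (Fin n) ℝ × Matrix (Fin n) (Fin n) ℝ × ℝ)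
    refine Metric.isCompact_of_isClosed_isBounded hTclosed ?_
    refine isBounded_iff_forall_norm_le.2 ⟨max b 1, fun p hp => ?_⟩
    obtain ⟨h1, -, h3, h4, -⟩ := hp
    have h5 : ‖p.2.1‖ ≤ 1 := by linarith
    have h6 : ‖p.2.2‖ ≤ 1 := by
      rw [Real.norm_of_nonneg h3]; linarith [norm_nonneg p.2.1]
    exact max_le_max h1 (max_le h5 h6)
  convert hTcompact.image continuous_fst using 1
  ext K
  simp only [mem_ofPred_eq, mem_image]
  constructor
  · rintro ⟨hK, hc⟩
    set X := closedLoopGramian A B x₀ K with hX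
    have hpos : 0 < 1 + ‖X‖ := by positivity
    set ε := (1 + ‖X‖)⁻¹ with hε
    have hε0 : 0 < ε := by positivity
    refine ⟨(K, ε • X, ε), ⟨hb K hK hc, (closedLoopGramian_posDef hx₀ hK).posSemidef.smul hε0.le,
      hε0.le, ?_, ?_, ?_⟩, rfl⟩
    · rw [norm_smul, Real.norm_of_nonneg hε0.le, hε]
      field_simp
      ring
    · rw [Matrix.mul_smul, Matrix.smul_mul, ← smul_add, closedLoopGramian_spec hK, smul_neg]
    · rw [Matrix.mul_smul, Matrix.trace_smul, ← lqrCost_eq_trace_gramian hQ hR hK, smul_eq_mul]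
      exact mul_le_mul_of_nonneg_left hc hε0.le
  · rintro ⟨⟨K', Y, ε⟩, ⟨-, hY, hε, hnorm, hlyap, hcost⟩, rfl⟩
    simp only at hY hε hnorm hlyap hcost ⊢
    rcases hε.eq_or_lt with h0 | hε0
    -- At ε = 0 the cost condition forces QY = 0 and K'Y = 0, so the feedback drops out of the
    -- Lyapunov equation and observability gives Y = 0, against the normalization.
    · exfalso
      subst h0
      rw [zero_smul, neg_zero] at hlyap
      rw [zero_mul, Matrix.add_mul, Matrix.trace_add] at hcost
      have hKRK : (K'ᵀ * R * K').PosSemidef := by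
        simpa using hR.posSemidef.conjTranspose_mul_mul_same K'
      have hQY := hQ.mul_eq_zero_of_trace_nonpos hY
        (by linarith [hKRK.trace_mul_nonneg_of_real hY])
      have hKY := hKRK.mul_eq_zero_of_trace_nonpos hY
        (by linarith [hQ.trace_mul_nonneg_of_real hY])
      obtain ⟨r, hr, hRr⟩ := hR.exists_pos_le
      have hRt : Rᵀ = R := hR.isHermitian.eq
      have hYt : Yᵀ = Y := hY.isHermitian.eq
      have hKY0 : K' * Y = 0 := by
        have h1 := le_frobenius_inner_self_mul hRt hRr (K' * Y)
        have h2 : ⟪R * (K' * Y), K' * Y⟫ = 0 := by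
          rw [real_inner_comm, frobenius_inner_def, Matrix.transpose_mul, Matrix.mul_assoc,
            ← Matrix.mul_assoc R, ← Matrix.mul_assoc K'ᵀ, ← Matrix.mul_assoc K'ᵀ, hKY,
            Matrix.mul_zero, Matrix.trace_zero]
        rw [h2] at h1
        have h3 : ‖K' * Y‖ ^ 2 ≤ 0 := by nlinarith
        exact norm_eq_zero.1 (pow_eq_zero_iff two_ne_zero |>.1 (le_antisymm h3 (sq_nonneg _)))
      have hYK : Y * K'ᵀ = 0 := by
        have := congrArg Matrix.transpose hKY0
        rwa [Matrix.transpose_mul, hYt, Matrix.transpose_zero] at this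
      have hAY : A * Y + Y * Aᵀ = 0 := by
        rw [Matrix.sub_mul, Matrix.mul_assoc, hKY0, Matrix.mul_zero, sub_zero,
          Matrix.transpose_sub, Matrix.transpose_mul, Matrix.mul_sub, ← Matrix.mul_assoc Y, hYK,
          Matrix.zero_mul, sub_zero] at hlyap
        exact hlyap
      rw [hobs.eq_zero hY hAY hQY] at hnorm
      simp at hnorm
    -- For ε > 0 the matrix Y is itself a Lyapunov certificate of stability, and uniqueness
    -- identifies it with ε times the Gramian.
    · have hK : K' ∈ stabilizingGains A B := by
        refine isHurwitz_of_lyapunov hY fun w hw => ?_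
        rw [hlyap, Matrix.neg_mulVec, dotProduct_neg, Matrix.smul_mulVec, dotProduct_smul,
          smul_eq_mul]
        exact neg_lt_zero.2 (mul_pos hε0 ((initialMoment_posDef hx₀).dotProduct_mulVec_pos hw))
      refine ⟨hK, ?_⟩
      have hYX : Y = ε • closedLoopGramian A B x₀ K' := by
        refine sub_eq_zero.1 (IsHurwitz.eq_zero_of_lyapunov hK ?_)
        rw [Matrix.mul_sub, Matrix.sub_mul Y, sub_add_sub_comm, hlyap, Matrix.mul_smul,
          Matrix.smul_mul, ← smul_add, closedLoopGramian_spec hK, smul_neg, sub_self]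
      rw [hYX, Matrix.mul_smul, Matrix.trace_smul, ← lqrCost_eq_trace_gramian hQ hR hK,
        smul_eq_mul] at hcost
      exact le_of_mul_le_mul_left hcost hε0

end SublevelSets

/-! ### The minimizer and gradient dominance -/

section Minimizer

open scoped RealInnerProductSpace

variable {n m : ℕ} {A : Matrix (Fin n) (Fin n) ℝ} {B : Matrix (Fin n) (Fin m) ℝ}
  {Q : Matrix (Fin n) (Fin n) ℝ} {R : Matrix (Fin m) (Fin m) ℝ} {x₀ : Fin n → Fin n → ℝ}

theorem exists_isMinOn_lqrCost (hAB : IsStabilizable A B) (hQ : Q.PosSemidef) (hR : R.PosDef)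
    (hobs : ImaginaryAxisObservable Q A) (hx₀ : Submodule.span ℝ (Set.range x₀) = ⊤) :
    ∃ K ∈ stabilizingGains A B, ∀ L ∈ stabilizingGains A B,
      lqrCost A B Q R x₀ K ≤ lqrCost A B Q R x₀ L := by
  obtain ⟨K₁, hK₁⟩ := hAB
  obtain ⟨K, hK, hmin⟩ := (isCompact_sublevel_lqrCost hQ hR hobs hx₀
    (lqrCost A B Q R x₀ K₁)).exists_isMinOn ⟨K₁, hK₁, le_rfl⟩
    (f := lqrCost A B Q R x₀) fun L hL =>
      (differentiableAt_lqrCost hQ hR hL.1).continuousAt.continuousWithinAt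
  refine ⟨K, hK.1, fun L hL => ?_⟩
  rcases le_total (lqrCost A B Q R x₀ L) (lqrCost A B Q R x₀ K₁) with h | h
  · exact hmin ⟨hL, h⟩
  · exact hK.2.trans h

/-- The residual `R K - Bᵀ P(K)` vanishes at a minimizer of the cost. -/
theorem gainResidual_eq_zero (hQ : Q.PosSemidef) (hR : R.PosDef)
    (hx₀ : Submodule.span ℝ (Set.range x₀) = ⊤) {K : Matrix (Fin m) (Fin n) ℝ}
    (hK : K ∈ stabilizingGains A B)
    (hmin : ∀ L ∈ stabilizingGains A B, lqrCost A B Q R x₀ K ≤ lqrCost A B Q R x₀ L) :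
    gainResidual A B Q R K = 0 := by
  have hloc : IsLocalMin (lqrCost A B Q R x₀) K := by
    filter_upwards [(isOpen_stabilizingGains A B).mem_nhds hK] with L hL using hmin L hL
  have hgrad : gradient (lqrCost A B Q R x₀) K = 0 := by
    rw [gradient, hloc.fderiv_eq_zero, map_zero]
  rw [gradient_lqrCost hQ hR hK, smul_eq_zero_iff_right two_ne_zero] at hgrad
  -- The gradient is 2 E X with `X` positive definite, so it vanishes only if E does.
  obtain ⟨a, ha, hX⟩ := (closedLoopGramian_posDef hx₀ hK).exists_pos_le
  have h := le_frobenius_inner_mul_self hX (gainResidual A B Q R K)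
  rw [hgrad, inner_zero_left] at h
  have h2 : ‖gainResidual A B Q R K‖ ^ 2 ≤ 0 := by nlinarith
  exact norm_eq_zero.1 (pow_eq_zero_iff two_ne_zero |>.1 (le_antisymm h2 (sq_nonneg _)))

/-- The excess of the cost over its minimum is a quadratic form in the distance to the
minimizer. -/
theorem lqrCost_sub_min (hQ : Q.PosSemidef) (hR : R.PosDef) {K : Matrix (Fin m) (Fin n) ℝ}
    (hK : K ∈ stabilizingGains A B) (hres : gainResidual A B Q R K = 0)
    {L : Matrix (Fin m) (Fin n) ℝ} (hL : L ∈ stabilizingGains A B) :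
    lqrCost A B Q R x₀ L - lqrCost A B Q R x₀ K =
      ⟪R * (L - K) * closedLoopGramian A B x₀ L, L - K⟫ := by
  rw [lqrCost_sub hQ hR hK hL, hres, Matrix.zero_mul, inner_zero_left, mul_zero, zero_add]

/-- On a sublevel set the closed-loop Gramians are uniformly bounded from below and above. -/
theorem exists_gramian_bounds (hQ : Q.PosSemidef) (hR : R.PosDef)
    (hobs : ImaginaryAxisObservable Q A) (hx₀ : Submodule.span ℝ (Set.range x₀) = ⊤) (c : ℝ) :
    ∃ a > 0, ∃ b : ℝ, ∀ K ∈ stabilizingGains A B, lqrCost A B Q R x₀ K ≤ c →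
      (∀ w, a * (w ⬝ᵥ w) ≤ w ⬝ᵥ (closedLoopGramian A B x₀ K *ᵥ w)) ∧
        ‖closedLoopGramian A B x₀ K‖ ≤ b := by
  have hcomp := isCompact_sublevel_lqrCost (A := A) (B := B) hQ hR hobs hx₀ c
  obtain ⟨b, hb⟩ := hcomp.exists_bound_of_continuousOn (f := closedLoopGramian A B x₀)
    fun K hK => (contDiffAt_closedLoopGramian (r := 0) hK.1).continuousAt.continuousWithinAt
  obtain ⟨d, hd⟩ := hcomp.exists_bound_of_continuousOn (f := fun K => A - B * K)
    (by fun_prop)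
  obtain ⟨s, hs, hS⟩ := (initialMoment_posDef hx₀).exists_pos_le
  -- The general lower bound for Lyapunov solutions, with `d` bounding ‖A - BK‖ over the compact
  -- sublevel set.
  refine ⟨s / (2 * (|d| + 1)), by positivity, b, fun K hK hKc => ⟨fun w => ?_, hb K ⟨hK, hKc⟩⟩⟩
  refine le_trans ?_ (le_dotProduct_of_lyapunov (closedLoopGramian_posDef hx₀ hK)
    (closedLoopGramian_spec hK) hs hS w)
  have hw : 0 ≤ w ⬝ᵥ w := by simpa using dotProduct_star_self_nonneg w
  have hdK := (hd K ⟨hK, hKc⟩).trans (le_abs_self d)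
  gcongr

/-- The Polyak–Łojasiewicz inequality for the cost on a sublevel set. -/
theorem exists_gradient_dominance (hQ : Q.PosSemidef) (hR : R.PosDef)
    (hobs : ImaginaryAxisObservable Q A) (hx₀ : Submodule.span ℝ (Set.range x₀) = ⊤)
    {Kstar : Matrix (Fin m) (Fin n) ℝ} (hKstar : Kstar ∈ stabilizingGains A B) (c : ℝ)
    (hc : lqrCost A B Q R x₀ Kstar ≤ c) :
    ∃ α > 0, ∀ K ∈ stabilizingGains A B, lqrCost A B Q R x₀ K ≤ c →
      α * (lqrCost A B Q R x₀ K - lqrCost A B Q R x₀ Kstar) ≤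
        ‖gradient (lqrCost A B Q R x₀) K‖ ^ 2 := by
  obtain ⟨a, ha, b, hab⟩ := exists_gramian_bounds (A := A) (B := B) hQ hR hobs hx₀ c
  obtain ⟨r, hr, hRr⟩ := hR.exists_pos_le
  have hRt : Rᵀ = R := hR.isHermitian.eq
  -- Expanding from K towards K⋆ and completing the square in ‖K⋆ - K‖ gives ra (f - f⋆) ≤
  -- ‖E‖²‖X(K⋆)‖², while ‖∇f‖ = 2‖EX‖ ≥ 2a‖E‖. The summand 1 only keeps the denominator positive.
  refine ⟨4 * a ^ 2 * (r * a) / (‖closedLoopGramian A B x₀ Kstar‖ ^ 2 + 1), by positivity,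
    fun K hK hKc => ?_⟩
  have hsub := lqrCost_sub (x₀ := x₀) hQ hR hK hKstar
  have hquad := le_frobenius_inner_mul_mul (closedLoopGramian_posDef hx₀ hKstar).posSemidef hr.le
    hRt hRr (hab Kstar hKstar hc).1 (Kstar - K)
  have hE := le_frobenius_inner_mul_self (hab K hK hKc).1 (gainResidual A B Q R K)
  rw [gradient_lqrCost hQ hR hK, norm_smul, Real.norm_ofNat]
  set E := gainResidual A B Q R K
  set X := closedLoopGramian A B x₀ K
  set Xs := closedLoopGramian A B x₀ Kstar
  set f := lqrCost A B Q R x₀ K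
  set fs := lqrCost A B Q R x₀ Kstar
  set d := ‖Kstar - K‖
  have hEX : a * ‖E‖ ≤ ‖E * X‖ := by
    rcases (norm_nonneg E).eq_or_lt with h0 | h0
    · rw [← h0, mul_zero]; exact norm_nonneg _
    · refine le_of_mul_le_mul_right ?_ h0
      calc a * ‖E‖ * ‖E‖ = a * ‖E‖ ^ 2 := by ring
        _ ≤ ‖E * X‖ * ‖E‖ := hE.trans (real_inner_le_norm _ _)
  have hcross : -(‖E‖ * ‖Xs‖ * d) ≤ ⟪E * Xs, Kstar - K⟫ :=
    (neg_le_neg (mul_le_mul_of_nonneg_right (Matrix.frobenius_norm_mul E Xs)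
      (norm_nonneg _))).trans (abs_le.1 (abs_real_inner_le_norm _ _)).1
  have h1 : f - fs ≤ 2 * (‖E‖ * ‖Xs‖ * d) - r * a * d ^ 2 := by linarith
  have hra : 0 < r * a := mul_pos hr ha
  have h2 : r * a * (f - fs) ≤ ‖E‖ ^ 2 * (‖Xs‖ ^ 2 + 1) := by
    nlinarith [mul_le_mul_of_nonneg_left h1 hra.le, sq_nonneg (r * a * d - ‖E‖ * ‖Xs‖),
      sq_nonneg ‖E‖]
  have h3 : (a * ‖E‖) ^ 2 ≤ ‖E * X‖ ^ 2 := by gcongr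
  rw [div_mul_eq_mul_div, div_le_iff₀ (by positivity)]
  calc 4 * a ^ 2 * (r * a) * (f - fs) = 4 * a ^ 2 * (r * a * (f - fs)) := by ring
    _ ≤ 4 * a ^ 2 * (‖E‖ ^ 2 * (‖Xs‖ ^ 2 + 1)) := by gcongr
    _ = 4 * (a * ‖E‖) ^ 2 * (‖Xs‖ ^ 2 + 1) := by ring
    _ ≤ 4 * ‖E * X‖ ^ 2 * (‖Xs‖ ^ 2 + 1) := by gcongr
    _ = (2 * ‖E * X‖) ^ 2 * (‖Xs‖ ^ 2 + 1) := by ring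

end Minimizer

/-! ### Unique minimizer and exponential convergence of the flow -/

theorem mainTheorem2 {n m : ℕ}
    (A : Matrix (Fin n) (Fin n) ℝ) (B : Matrix (Fin n) (Fin m) ℝ)
    (Q : Matrix (Fin n) (Fin n) ℝ) (R : Matrix (Fin m) (Fin m) ℝ)
    (hAB : IsStabilizable A B) (hQ : Q.PosSemidef) (hR : R.PosDef)
    (hobs : ImaginaryAxisObservable Q A)
    (x₀ : Fin n → Fin n → ℝ) (hx₀ : Submodule.span ℝ (Set.range x₀) = ⊤) :
    ∃ Kstar ∈ stabilizingGains A B,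
      -- `Kstar` is the unique global minimizer of the cost over the stabilizing gains
      (∀ K ∈ stabilizingGains A B, lqrCost A B Q R x₀ Kstar ≤ lqrCost A B Q R x₀ K) ∧
      (∀ K ∈ stabilizingGains A B,
        lqrCost A B Q R x₀ K ≤ lqrCost A B Q R x₀ Kstar → K = Kstar) ∧
      ∀ K₀ ∈ stabilizingGains A B,
        -- existence, smoothness and uniqueness of the gradient flow started at `K₀`
        (∃ K : ℝ → Matrix (Fin m) (Fin n) ℝ,
          IsGradientFlowFrom A B Q R x₀ K₀ K ∧
          ContDiffOn ℝ ∞ K (Set.Ici 0) ∧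
          ∀ L : ℝ → Matrix (Fin m) (Fin n) ℝ,
            IsGradientFlowFrom A B Q R x₀ K₀ L → Set.EqOn L K (Set.Ici 0)) ∧
        -- exponential decay, with constants valid on the whole sublevel set of `K₀`
        ∃ α > (0 : ℝ), ∃ c > (0 : ℝ),
          ∀ L₀ ∈ stabilizingGains A B, lqrCost A B Q R x₀ L₀ ≤ lqrCost A B Q R x₀ K₀ →
            ∀ L : ℝ → Matrix (Fin m) (Fin n) ℝ, IsGradientFlowFrom A B Q R x₀ L₀ L →
              ∀ t : ℝ, 0 ≤ t →
                lqrCost A B Q R x₀ (L t) - lqrCost A B Q R x₀ Kstar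
                  ≤ Real.exp (-α * t) * (lqrCost A B Q R x₀ L₀ - lqrCost A B Q R x₀ Kstar) ∧
                ‖L t - Kstar‖ ^ 2 ≤ c * Real.exp (-α * t) * ‖L₀ - Kstar‖ ^ 2 := by
  have hRt : Rᵀ = R := hR.isHermitian.eq
  obtain ⟨r, hr, hRr⟩ := hR.exists_pos_le
  obtain ⟨Kstar, hKs, hmin⟩ := exists_isMinOn_lqrCost hAB hQ hR hobs hx₀
  have hres := gainResidual_eq_zero hQ hR hx₀ hKs hmin
  have hdiff : ∀ K ∈ stabilizingGains A B, DifferentiableAt ℝ (lqrCost A B Q R x₀) K :=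
    fun K hK => differentiableAt_lqrCost hQ hR hK
  -- two-sided quadratic bounds on sublevel sets
  have hbounds : ∀ c, ∃ p > 0, ∃ q : ℝ, ∀ K ∈ stabilizingGains A B, lqrCost A B Q R x₀ K ≤ c →
      p * ‖K - Kstar‖ ^ 2 ≤ lqrCost A B Q R x₀ K - lqrCost A B Q R x₀ Kstar ∧
      lqrCost A B Q R x₀ K - lqrCost A B Q R x₀ Kstar ≤ q * ‖K - Kstar‖ ^ 2 := by
    intro c
    obtain ⟨a, ha, b, hab⟩ := exists_gramian_bounds (A := A) (B := B) hQ hR hobs hx₀ c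
    refine ⟨r * a, by positivity, ‖R‖ * b, fun K hK hKc => ?_⟩
    obtain ⟨h1, h2⟩ := hab K hK hKc
    rw [lqrCost_sub_min hQ hR hKs hres hK]
    refine ⟨le_frobenius_inner_mul_mul (closedLoopGramian_posDef hx₀ hK).posSemidef hr.le hRt hRr
      h1 _, (frobenius_inner_mul_mul_le _ _ _).trans ?_⟩
    gcongr
  refine ⟨Kstar, hKs, hmin, fun K hK hle => ?_, fun K₀ hK₀ => ⟨?_, ?_⟩⟩
  -- Quadratic growth with p > 0 leaves no second minimizer.
  · obtain ⟨p, hp, q, hpq⟩ := hbounds (lqrCost A B Q R x₀ K)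
    have h1 := (hpq K hK le_rfl).1
    have h2 : ‖K - Kstar‖ ^ 2 ≤ 0 := by nlinarith
    exact sub_eq_zero.1 (norm_eq_zero.1
      (pow_eq_zero_iff two_ne_zero |>.1 (le_antisymm h2 (sq_nonneg _))))
  · obtain ⟨K, h0, hmem, hflow, hsmooth, huniq⟩ := exists_gradientFlow_of_isCompact_sublevel
      (isOpen_stabilizingGains A B) hdiff (contDiffOn_gradient_lqrCost hQ hR) hK₀
      (isCompact_sublevel_lqrCost hQ hR hobs hx₀ (lqrCost A B Q R x₀ K₀))
    exact ⟨K, ⟨h0, hmem, hflow⟩, hsmooth.contDiffOn,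
      fun L hL => huniq L hL.init hL.mem hL.deriv⟩
  · obtain ⟨α, hα, hPL⟩ := exists_gradient_dominance hQ hR hobs hx₀ hKs _ (hmin K₀ hK₀)
    obtain ⟨p, hp, q, hpq⟩ := hbounds (lqrCost A B Q R x₀ K₀)
    -- Lower quadratic bound at `L t`, decay of the cost, upper bound at `L₀`: the ratio is |q| / p,
    -- and the added 1 makes `c` positive. The cost decreases along the flow, so the constants of
    -- the sublevel set of `K₀` apply at all times.
    refine ⟨α, hα, |q| / p + 1, by positivity, fun L₀ hL₀ hle L hL t ht => ?_⟩
    have hdecay := gradientFlow_exp_decay hdiff hPL hL.mem (by rw [hL.init]; exact hle) hL.deriv ht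
    have hmono := le_of_gradientFlow hdiff hL.mem hL.deriv ht
    rw [hL.init] at hdecay hmono
    refine ⟨hdecay, ?_⟩
    have h1 := (hpq (L t) (hL.mem t ht) (hmono.trans hle)).1
    have h2 := (hpq L₀ hL₀ hle).2
    have hexp := Real.exp_pos (-α * t)
    have h3 : p * ‖L t - Kstar‖ ^ 2 ≤ Real.exp (-α * t) * (|q| * ‖L₀ - Kstar‖ ^ 2) :=
      h1.trans (hdecay.trans (mul_le_mul_of_nonneg_left
        (h2.trans (mul_le_mul_of_nonneg_right (le_abs_self q) (sq_nonneg _))) hexp.le))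
    calc ‖L t - Kstar‖ ^ 2 ≤ Real.exp (-α * t) * (|q| * ‖L₀ - Kstar‖ ^ 2) / p := by
          rwa [le_div_iff₀' hp]
      _ = |q| / p * Real.exp (-α * t) * ‖L₀ - Kstar‖ ^ 2 := by ring
      _ ≤ (|q| / p + 1) * Real.exp (-α * t) * ‖L₀ - Kstar‖ ^ 2 := by
          gcongr
          linarith
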